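/- There exist absolute constants $C_0, c, C > 0$ such that the following holds. Let $1\le s\le d$ and $m\ge C_0\, s\log(ed/s)$ be integers. Let $a_1,\dots,a_m$ be i.i.d. complex Gaussian random vectors in $\mathbb{C}^d$, $a_j\sim \frac{1}{\sqrt2}\mathcal N(0,I_d)+\frac{i}{\sqrt2}\mathcal N(0,I_d)$ (real and imaginary parts independent), and let $\eta\in\mathbb{R}^m$ be a fixed vector, or a random vector independent of $(a_1,\dots,a_m)$. Then with probability at least $1-5\exp(-cm)$ the following holds: for every $s$-sparse vector $x_0\in\mathbb{C}^d$ (that is, with at most $s$ nonzero entries) and every solution $\hat x\in\mathbb{C}^d$ of $$\min_{x\in\mathbb{C}^d}\ \sum_{j=1}^m\bigl(|\langle a_j,x\rangle|^2-b_j\bigr)^2\quad\text{subject to}\quad \|x\|_1\le R,$$ with $b_j=|\langle a_j,x_0\rangle|^2+\eta_j$ $(j=1,\dots,m)$ and $R=\|x_0\|_1$, one has $$\min_{\theta\in[0,2\pi)}\|\hat x-e^{i\theta}x_0\|_2\ \le\ C\min\left\{\frac{\sqrt{\|\eta\|_2}}{m^{1/4}},\ \frac{\|\eta\|_2}{\|x_0\|_2\sqrt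 m}\right\}.$$ (For $x_0=0$ the constraint forces $\hat x=0$; the right-hand side is then read as $0$.) -/

import Mathlib

open MeasureTheory ProbabilityTheory

noncomputable section

/-- The law of the standard complex Gaussian vector
`(1/√2) N(0, I_d) + (i/√2) N(0, I_d)` on `ℂ^d`: the real part and the imaginary part are
independent standard Gaussian vectors of `ℝ^d`, each scaled by `1/√2`. -/
def complexGaussian (d : ℕ) : Measure (EuclideanSpace ℂ (Fin d)) :=
  ((stdGaussian (EuclideanSpace ℝ (Fin d))).prod (stdGaussian (EuclideanSpace ℝ (Fin d)))).map
    (fun p => WithLp.toLp 2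
      (fun i => ((1 / √2 : ℝ) : ℂ) * (p.1 i : ℂ) + Complex.I * ((1 / √2 : ℝ) : ℂ) * (p.2 i : ℂ)))

instance complexGaussian_isProbabilityMeasure (d : ℕ) :
    IsProbabilityMeasure (complexGaussian d) :=
  Measure.isProbabilityMeasure_map (by fun_prop)

/-- `x` has at most `s` nonzero entries. -/
def IsSparse {d : ℕ} (s : ℕ) (x : EuclideanSpace ℂ (Fin d)) : Prop :=
  {i : Fin d | x i ≠ 0}.ncard ≤ s

/-- The `ℓ¹` norm on `ℂ^d`. -/
def l1norm {d : ℕ} (x : EuclideanSpace ℂ (Fin d)) : ℝ := ∑ i, ‖x i‖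

/-- The noisy intensity measurements `b_j = |⟨a_j, x₀⟩|² + η_j`. -/
def intensity {d m : ℕ} (a : Fin m → EuclideanSpace ℂ (Fin d)) (x₀ : EuclideanSpace ℂ (Fin d))
    (η : EuclideanSpace ℝ (Fin m)) (j : Fin m) : ℝ :=
  ‖inner ℂ (a j) x₀‖ ^ 2 + η j

/-- The intensity-based empirical loss `∑_j (|⟨a_j, x⟩|² - b_j)²`. -/
def intensityLoss {d m : ℕ} (a : Fin m → EuclideanSpace ℂ (Fin d)) (b : Fin m → ℝ)
    (x : EuclideanSpace ℂ (Fin d)) : ℝ :=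
  ∑ j, (‖inner ℂ (a j) x‖ ^ 2 - b j) ^ 2

/-- `xhat` is a (global) solution of the program
`min ∑_j (|⟨a_j, x⟩|² - b_j)²` subject to `‖x‖₁ ≤ R`. -/
def IsSolution {d m : ℕ} (a : Fin m → EuclideanSpace ℂ (Fin d)) (b : Fin m → ℝ) (R : ℝ)
    (xhat : EuclideanSpace ℂ (Fin d)) : Prop :=
  l1norm xhat ≤ R ∧ IsMinOn (intensityLoss a b) {x | l1norm x ≤ R} xhat

/-- The distance up to a global phase, `min_{θ ∈ [0, 2π)} ‖x - e^{iθ} y‖`. -/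
def phaseDist {d : ℕ} (x y : EuclideanSpace ℂ (Fin d)) : ℝ :=
  ⨅ θ : Set.Ico (0 : ℝ) (2 * Real.pi), ‖x - Complex.exp (Complex.I * ((θ : ℝ) : ℂ)) • y‖

/-- The infimum in `phaseDist` is a minimum. -/
theorem phaseDist_attained {d : ℕ} (x y : EuclideanSpace ℂ (Fin d)) :
    ∃ θ ∈ Set.Ico (0 : ℝ) (2 * Real.pi),
      phaseDist x y = ‖x - Complex.exp (Complex.I * (θ : ℂ)) • y‖ ∧
      ∀ t ∈ Set.Ico (0 : ℝ) (2 * Real.pi),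
        phaseDist x y ≤ ‖x - Complex.exp (Complex.I * (t : ℂ)) • y‖ := by
  set f : ℝ → ℝ := fun t => ‖x - Complex.exp (Complex.I * (t : ℂ)) • y‖ with hf
  have hle : ∀ t ∈ Set.Ico (0 : ℝ) (2 * Real.pi), phaseDist x y ≤ f t := fun t ht =>
    ciInf_le (f := fun θ : Set.Ico (0 : ℝ) (2 * Real.pi) => f θ)
      ⟨0, by rintro _ ⟨θ, rfl⟩; exact norm_nonneg _⟩ ⟨t, ht⟩
  have hpi : (0 : ℝ) < 2 * Real.pi := by positivity
  obtain ⟨t, ht, hmin⟩ := (isCompact_Icc (a := (0 : ℝ)) (b := 2 * Real.pi)).exists_isMinOn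
    (Set.nonempty_Icc.2 hpi.le) (f := f) (by fun_prop)
  obtain ⟨t', ht', heq⟩ : ∃ t' ∈ Set.Ico (0 : ℝ) (2 * Real.pi), f t' = f t := by
    rcases ht.2.lt_or_eq with h | h
    · exact ⟨t, ⟨ht.1, h⟩, rfl⟩
    · refine ⟨0, ⟨le_rfl, hpi⟩, ?_⟩
      have : Complex.exp (Complex.I * ((2 * Real.pi : ℝ) : ℂ)) = 1 := by
        rw [mul_comm]; push_cast; exact Complex.exp_two_pi_mul_I
      simp only [hf, h, this]
      simp
  refine ⟨t', ht', le_antisymm (hle t' ht') ?_, hle⟩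
  have : Nonempty (Set.Ico (0 : ℝ) (2 * Real.pi)) := ⟨⟨t', ht'⟩⟩
  refine le_ciInf fun θ => ?_
  change f t' ≤ f θ
  rw [heq]
  exact hmin ⟨θ.2.1, θ.2.2.le⟩

end

noncomputable section

/-! The minimiser `xhat` does at least as well as the feasible point `x₀`, whose residual is `η`. So
the intensity differences `q_j = |⟨a_j, xhat⟩|² - |⟨a_j, x₀⟩|²` satisfy `‖q - η‖ ≤ ‖η‖`, hence `∑
|q_j| ≤ 2 √m ‖η‖`. Rotate `x₀` to `y` so that `⟨xhat, y⟩ ≥ 0`. Then `q_j = Re (⟨a_j, u⟩ conj ⟨a_j,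
v⟩)` with `u = xhat + y` and `v = xhat - y`. It remains to bound `∑ |q_j|` below by multiples of `m
‖v‖ ‖y‖` and `m ‖v‖²`; these give the two terms of the minimum (`cone_lower_bound`,
`phaseDist_le_of_sparse_bounds`).

The phase alignment matters twice: it makes `⟨u, v⟩` real, without which the cross terms could all
vanish (take `v = i u`), and it gives `‖v‖ ≤ ‖u‖`. The `ℓ¹` constraint puts `v` in the usual cone,
so `v` is a sparse vector plus a small tail (`exists_restrictTo_tail`). Since `y` is sparse, `u` has
the same tail. The lower bound on sparse pairs (`SparseLower`) then passes to `(u, v)`, with the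
tail errors controlled by `SparseUpper`.

Both sparse bounds hold on one event, uniformly in `x₀`. For a fixed pair with nearly real inner
product, a small-ball estimate (`small_ball`) and an exponential Markov inequality give
`lower_tail`; Gaussian square-exponential moments give `exists_upper_tail`. A support-preserving net
(`exists_sparse_net`) of cardinality `exp (O(s log(ed/s)))` and a union bound finish the argument
(`exists_sparse_bounds_event`). -/

/-- `x` vanishes outside `T`. -/
def SupportedOn {d : ℕ} (T : Finset (Fin d)) (x : EuclideanSpace ℂ (Fin d)) : Prop :=
  ∀ i, i ∉ T → x i = 0

/-- The restriction of `x` to the coordinates in `T`. -/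
def restrictTo {d : ℕ} (T : Finset (Fin d)) (x : EuclideanSpace ℂ (Fin d)) :
    EuclideanSpace ℂ (Fin d) :=
  WithLp.toLp 2 (fun i => if i ∈ T then x i else 0)

/-- The linear map `z ↦ (⟨a_j, z⟩)_j`. -/
def measMap {d m : ℕ} (a : Fin m → EuclideanSpace ℂ (Fin d)) :
    EuclideanSpace ℂ (Fin d) →ₗ[ℂ] EuclideanSpace ℂ (Fin m) where
  toFun z := WithLp.toLp 2 (fun j => inner ℂ (a j) z)
  map_add' x y := by ext j; simp
  map_smul' c x := by ext j; simp

/-! ### Coordinate restrictions, `ℓ¹` norms and block decomposition. -/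

section Restrict

variable {d : ℕ}

@[simp] lemma restrictTo_apply (T : Finset (Fin d)) (x : EuclideanSpace ℂ (Fin d)) (i : Fin d) :
    restrictTo T x i = if i ∈ T then x i else 0 := rfl

lemma supportedOn_restrictTo (T : Finset (Fin d)) (x : EuclideanSpace ℂ (Fin d)) :
    SupportedOn T (restrictTo T x) := fun i hi => by simp [hi]

lemma SupportedOn.mono {T T' : Finset (Fin d)} {x : EuclideanSpace ℂ (Fin d)}
    (h : SupportedOn T x) (hT : T ⊆ T') : SupportedOn T' x := fun i hi => h i fun h' => hi (hT h')

lemma SupportedOn.restrictTo_eq {T : Finset (Fin d)} {x : EuclideanSpace ℂ (Fin d)}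
    (h : SupportedOn T x) : restrictTo T x = x := by
  ext i
  by_cases hi : i ∈ T
  · simp [hi]
  · simp [hi, h i hi]

lemma restrictTo_sub (T : Finset (Fin d)) (x y : EuclideanSpace ℂ (Fin d)) :
    restrictTo T (x - y) = restrictTo T x - restrictTo T y := by
  ext i; by_cases hi : i ∈ T <;> simp [hi]

lemma restrictTo_add (T : Finset (Fin d)) (x y : EuclideanSpace ℂ (Fin d)) :
    restrictTo T (x + y) = restrictTo T x + restrictTo T y := by
  ext i; by_cases hi : i ∈ T <;> simp [hi]

lemma inner_restrictTo_left {T : Finset (Fin d)} (x : EuclideanSpace ℂ (Fin d))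
    {y : EuclideanSpace ℂ (Fin d)} (hy : SupportedOn T y) :
    inner ℂ (restrictTo T x) y = inner ℂ x y := by
  simp only [PiLp.inner_apply]
  refine Finset.sum_congr rfl fun i _ => ?_
  by_cases hi : i ∈ T
  · simp [hi]
  · simp [hi, hy i hi]

lemma norm_restrictTo_le_of_subset {T T' : Finset (Fin d)} (h : T ⊆ T')
    (x : EuclideanSpace ℂ (Fin d)) : ‖restrictTo T x‖ ≤ ‖restrictTo T' x‖ := by
  simp only [EuclideanSpace.norm_eq]
  refine Real.sqrt_le_sqrt (Finset.sum_le_sum fun i _ => ?_)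
  by_cases hi : i ∈ T
  · simp [hi, h hi]
  · simp [hi]

lemma l1norm_restrictTo (T : Finset (Fin d)) (x : EuclideanSpace ℂ (Fin d)) :
    l1norm (restrictTo T x) = ∑ i ∈ T, ‖x i‖ := by
  rw [l1norm, ← Finset.sum_subset (Finset.subset_univ T)]
  · exact Finset.sum_congr rfl fun i hi => by simp [hi]
  · intro i _ hi; simp [hi]

lemma l1norm_eq_add (T : Finset (Fin d)) (x : EuclideanSpace ℂ (Fin d)) :
    l1norm x = l1norm (restrictTo T x) + l1norm (x - restrictTo T x) := by
  simp only [l1norm, ← Finset.sum_add_distrib]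
  refine Finset.sum_congr rfl fun i _ => ?_
  by_cases hi : i ∈ T <;> simp [hi]

lemma l1norm_nonneg (x : EuclideanSpace ℂ (Fin d)) : 0 ≤ l1norm x :=
  Finset.sum_nonneg fun _ _ => norm_nonneg _

lemma l1norm_restrictTo_le (T : Finset (Fin d)) (x : EuclideanSpace ℂ (Fin d)) :
    l1norm (restrictTo T x) ≤ √(T.card : ℝ) * ‖restrictTo T x‖ := by
  rw [← Real.sqrt_sq (l1norm_nonneg _), EuclideanSpace.norm_eq, ← Real.sqrt_mul (by positivity)]
  refine Real.sqrt_le_sqrt ?_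
  have h2 : ∑ i, ‖restrictTo T x i‖ ^ 2 = ∑ i ∈ T, ‖x i‖ ^ 2 := by
    rw [← Finset.sum_subset (Finset.subset_univ T)]
    · exact Finset.sum_congr rfl fun i hi => by simp [hi]
    · intro i _ hi; simp [hi]
  rw [l1norm_restrictTo, h2]
  exact sq_sum_le_card_mul_sum_sq

/-- A vector whose entries are bounded by `b`, restricted to at most `k` coordinates. -/
lemma norm_restrictTo_le {T : Finset (Fin d)} {k : ℕ} (hT : T.card ≤ k)
    {x : EuclideanSpace ℂ (Fin d)} {b : ℝ} (hb : 0 ≤ b) (hx : ∀ i, ‖x i‖ ≤ b) :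
    ‖restrictTo T x‖ ≤ √(k : ℝ) * b := by
  have h2 : ∑ i, ‖restrictTo T x i‖ ^ 2 = ∑ i ∈ T, ‖x i‖ ^ 2 := by
    rw [← Finset.sum_subset (Finset.subset_univ T)]
    · exact Finset.sum_congr rfl fun i hi => by simp [hi]
    · intro i _ hi; simp [hi]
  rw [EuclideanSpace.norm_eq, h2, ← Real.sqrt_sq hb, ← Real.sqrt_mul (by positivity)]
  refine Real.sqrt_le_sqrt ?_
  calc ∑ i ∈ T, ‖x i‖ ^ 2 ≤ ∑ i ∈ T, b ^ 2 := by
        gcongr with i; exact hx i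
    _ = T.card * b ^ 2 := by simp
    _ ≤ k * b ^ 2 := by gcongr

/-- Among the sets of `k` indices there is one carrying the largest entries. -/
lemma exists_top_set {k : ℕ} (hk : k ≤ d) (x : EuclideanSpace ℂ (Fin d)) :
    ∃ T : Finset (Fin d), T.card = k ∧ ∀ i ∉ T, ∀ j ∈ T, ‖x i‖ ≤ ‖x j‖ := by
  have hne : (Finset.powersetCard k (Finset.univ : Finset (Fin d))).Nonempty :=
    Finset.powersetCard_nonempty.2 (by simpa using hk)
  -- A set of maximal total mass works: exchanging a member for a larger outsider would increase the
  -- sum.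
  obtain ⟨T, hT, hmax⟩ := Finset.exists_max_image _ (fun T => ∑ i ∈ T, ‖x i‖) hne
  rw [Finset.mem_powersetCard_univ] at hT
  refine ⟨T, hT, fun i hi j hj => ?_⟩
  have h1 : i ∉ T.erase j := fun h => hi (Finset.mem_of_mem_erase h)
  have := hmax (insert i (T.erase j)) (by
    rw [Finset.mem_powersetCard_univ, Finset.card_insert_of_notMem h1, Finset.card_erase_of_mem hj,
      hT]
    have := Finset.card_pos.2 ⟨j, hj⟩
    omega)
  simp only at this
  rw [Finset.sum_insert h1, ← Finset.add_sum_erase _ _ hj] at this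
  linarith

/-- Block decomposition: after removing the `k` largest entries, a subadditive functional that is
controlled by `L ‖·‖` on `k`-sparse vectors is controlled by `L ‖·‖₁ / √k`. -/
lemma exists_restrictTo_tail {k : ℕ} (hk : 0 < k) (x : EuclideanSpace ℂ (Fin d)) :
    ∃ T : Finset (Fin d), T.card ≤ k ∧ ∀ (p : EuclideanSpace ℂ (Fin d) → ℝ) (L : ℝ), 0 ≤ L →
      (∀ y z, p (y + z) ≤ p y + p z) →
      (∀ S : Finset (Fin d), S.card ≤ k → ∀ z, SupportedOn S z → p z ≤ L * ‖z‖) →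
      p (x - restrictTo T x) ≤ L * (l1norm x / √(k : ℝ)) := by
  have hk' : (0 : ℝ) < k := by exact_mod_cast hk
  induction hn : ({i | x i ≠ 0} : Finset (Fin d)).card using Nat.strong_induction_on
    generalizing x with
  | _ n ih =>
    subst hn
    by_cases hc : ({i | x i ≠ 0} : Finset (Fin d)).card ≤ k
    · refine ⟨_, hc, fun p L hL _ hp => ?_⟩
      have : SupportedOn ({i | x i ≠ 0} : Finset (Fin d)) x := fun i hi => by simpa using hi
      rw [this.restrictTo_eq, sub_self]
      refine (hp ∅ (by simp) 0 (fun i _ => by simp)).trans ?_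
      have := l1norm_nonneg x
      rw [norm_zero, mul_zero]; positivity
    · push Not at hc
      have hkd : k ≤ d := by
        refine hc.le.trans ((Finset.card_le_univ _).trans (by simp))
      obtain ⟨T, hT, htop⟩ := exists_top_set hkd x
      set w := x - restrictTo T x with hw
      have hwi : ∀ i, w i = if i ∈ T then 0 else x i := fun i => by
        by_cases hi : i ∈ T <;> simp [hw, hi]
      -- There are more than `k` nonzero entries, so the top `k` are all nonzero. Removing them
      -- shrinks the support and the induction proceeds.
      have hTne : ∀ j ∈ T, x j ≠ 0 := by
        intro j hj h0
        have hsub : ({i | x i ≠ 0} : Finset (Fin d)) ⊆ T := fun i hi => by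
          by_contra hiT
          have := htop i hiT j hj
          rw [h0, norm_zero] at this
          simp only [Finset.mem_filter_univ] at hi
          exact hi (norm_le_zero_iff.1 this)
        have := Finset.card_le_card hsub
        omega
      have hlt : ({i | w i ≠ 0} : Finset (Fin d)).card < ({i | x i ≠ 0} : Finset (Fin d)).card := by
        refine Finset.card_lt_card (Finset.ssubset_iff_of_subset ?_ |>.2 ?_)
        · intro i; simp only [Finset.mem_filter_univ, hwi]
          split_ifs <;> simp
        · obtain ⟨j, hj⟩ := Finset.card_pos.1 (hT ▸ hk)
          exact ⟨j, by simpa using hTne j hj, by simp [hwi, hj]⟩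
      obtain ⟨T', hT', h'⟩ := ih _ hlt w rfl
      refine ⟨T, hT.le, fun p L hL hadd hp => ?_⟩
      -- Every remaining entry is at most the average of the removed block. So each block has `ℓ²`
      -- norm at most `1/√k` times the `ℓ¹` norm of its predecessor, and these `ℓ¹` norms add up to
      -- at most `‖x‖₁`.
      have hb : ∀ i, ‖w i‖ ≤ l1norm (restrictTo T x) / k := by
        intro i
        rw [le_div_iff₀ hk', l1norm_restrictTo]
        by_cases hi : i ∈ T
        · simp only [hwi, hi, if_true, norm_zero, zero_mul]; positivity
        · simp only [hwi, hi, if_false]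
          calc ‖x i‖ * k = ∑ j ∈ T, ‖x i‖ := by simp [hT, mul_comm]
            _ ≤ _ := Finset.sum_le_sum fun j hj => htop i hi j hj
      have h1 : ‖restrictTo T' w‖ ≤ l1norm (restrictTo T x) / √(k : ℝ) := by
        refine (norm_restrictTo_le hT' (div_nonneg (l1norm_nonneg _) hk'.le) hb).trans (le_of_eq ?_)
        have h0 : √(k : ℝ) ≠ 0 := (Real.sqrt_pos.2 hk').ne'
        field_simp
        rw [Real.sq_sqrt hk'.le, mul_comm]
      have h2 := h' p L hL hadd hp
      have h3 := hp T' hT' _ (supportedOn_restrictTo T' w)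
      have h4 := hadd (restrictTo T' w) (w - restrictTo T' w)
      rw [add_sub_cancel] at h4
      calc p w ≤ L * ‖restrictTo T' w‖ + L * (l1norm w / √(k : ℝ)) := by linarith
        _ ≤ L * (l1norm (restrictTo T x) / √(k : ℝ)) + L * (l1norm w / √(k : ℝ)) := by gcongr
        _ = L * (l1norm x / √(k : ℝ)) := by rw [l1norm_eq_add T x]; ring

end Restrict

/-! ### From sparse bounds to the recovery estimate. -/

section Deterministic

open ComplexConjugate

variable {d m : ℕ}

@[simp] lemma measMap_apply (a : Fin m → EuclideanSpace ℂ (Fin d)) (z : EuclideanSpace ℂ (Fin d))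
    (j : Fin m) : measMap a z j = inner ℂ (a j) z := rfl

/-- The real cross term `Re (⟨a, u⟩ conj ⟨a, v⟩)`. -/
def crossTerm (a u v : EuclideanSpace ℂ (Fin d)) : ℝ :=
  (inner ℂ a u * conj (inner ℂ a v)).re

lemma sum_norm_mul_norm_le (a : Fin m → EuclideanSpace ℂ (Fin d))
    (u v : EuclideanSpace ℂ (Fin d)) :
    ∑ j, ‖inner ℂ (a j) u‖ * ‖inner ℂ (a j) v‖ ≤ ‖measMap a u‖ * ‖measMap a v‖ := by
  simp only [EuclideanSpace.norm_eq, measMap_apply]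
  exact Real.sum_mul_le_sqrt_mul_sqrt _ _ _

lemma abs_crossTerm_le (a u v : EuclideanSpace ℂ (Fin d)) :
    |crossTerm a u v| ≤ ‖inner ℂ a u‖ * ‖inner ℂ a v‖ := by
  refine (Complex.abs_re_le_norm _).trans (le_of_eq ?_)
  rw [norm_mul, RCLike.norm_conj]

lemma crossTerm_add_left (a u u' v : EuclideanSpace ℂ (Fin d)) :
    crossTerm a (u + u') v = crossTerm a u v + crossTerm a u' v := by
  simp only [crossTerm, inner_add_right, add_mul, Complex.add_re]

lemma crossTerm_add_right (a u v v' : EuclideanSpace ℂ (Fin d)) :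
    crossTerm a u (v + v') = crossTerm a u v + crossTerm a u v' := by
  simp only [crossTerm, inner_add_right, map_add, mul_add, Complex.add_re]

lemma crossTerm_add_sub (a x y : EuclideanSpace ℂ (Fin d)) :
    crossTerm a (x + y) (x - y) = ‖inner ℂ a x‖ ^ 2 - ‖inner ℂ a y‖ ^ 2 := by
  simp only [crossTerm, inner_add_right, inner_sub_right, Complex.sq_norm, Complex.normSq_apply,
    Complex.mul_re, Complex.add_re, Complex.add_im, map_sub, Complex.sub_re, Complex.sub_im,
    Complex.conj_re, Complex.conj_im]
  ring

/-- Perturbing the arguments of the cross term. -/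
lemma sum_abs_crossTerm_le_add (a : Fin m → EuclideanSpace ℂ (Fin d))
    (u v r q : EuclideanSpace ℂ (Fin d)) :
    ∑ j, |crossTerm (a j) u v| ≤ ∑ j, |crossTerm (a j) (u + r) (v + q)| +
      (‖measMap a u‖ * ‖measMap a q‖ + ‖measMap a r‖ * ‖measMap a v‖ +
        ‖measMap a r‖ * ‖measMap a q‖) := by
  have h : ∀ j, |crossTerm (a j) u v| ≤ |crossTerm (a j) (u + r) (v + q)| +
      (‖inner ℂ (a j) u‖ * ‖inner ℂ (a j) q‖ + ‖inner ℂ (a j) r‖ * ‖inner ℂ (a j) v‖ +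
        ‖inner ℂ (a j) r‖ * ‖inner ℂ (a j) q‖) := fun j => by
    have e : crossTerm (a j) u v = crossTerm (a j) (u + r) (v + q) -
        (crossTerm (a j) u q + crossTerm (a j) r v + crossTerm (a j) r q) := by
      simp only [crossTerm_add_left, crossTerm_add_right]; ring
    rw [e]
    refine (abs_sub _ _).trans (add_le_add le_rfl ?_)
    refine (abs_add_three _ _ _).trans ?_
    gcongr <;> exact abs_crossTerm_le _ _ _
  refine (Finset.sum_le_sum fun j _ => h j).trans ?_
  simp only [Finset.sum_add_distrib]
  gcongr <;> exact sum_norm_mul_norm_le _ _ _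

/-- `A` is bounded by `L √m` on `K`-sparse vectors. -/
def SparseUpper (a : Fin m → EuclideanSpace ℂ (Fin d)) (K : ℕ) (L : ℝ) : Prop :=
  ∀ T : Finset (Fin d), T.card ≤ K → ∀ z, SupportedOn T z → ‖measMap a z‖ ≤ L * √(m : ℝ) * ‖z‖

/-- The cross terms are bounded below in `ℓ¹` on pairs of vectors with a common support of size at
most `K` and real inner product. -/
def SparseLower (a : Fin m → EuclideanSpace ℂ (Fin d)) (K : ℕ) (c : ℝ) : Prop :=
  ∀ T : Finset (Fin d), T.card ≤ K → ∀ u v, SupportedOn T u → SupportedOn T v →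
    (inner ℂ u v : ℂ).im = 0 → c * m * (‖u‖ * ‖v‖) ≤ ∑ j, |crossTerm (a j) u v|

lemma norm_add_sq_sub_norm_sub_sq (x y : EuclideanSpace ℂ (Fin d)) :
    ‖x + y‖ ^ 2 - ‖x - y‖ ^ 2 = 4 * (inner ℂ x y : ℂ).re := by
  have h1 := @norm_add_sq ℂ _ _ _ _ x y
  have h2 := @norm_sub_sq ℂ _ _ _ _ x y
  simp only [RCLike.re_to_complex] at h1 h2
  linarith

lemma inner_add_sub_im (x y : EuclideanSpace ℂ (Fin d)) (h : (inner ℂ x y : ℂ).im = 0) :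
    (inner ℂ (x + y) (x - y) : ℂ).im = 0 := by
  have h3 : (inner ℂ y x : ℂ).im = 0 := by
    rw [← inner_conj_symm, Complex.conj_im, h, neg_zero]
  have h1 : (inner ℂ x x : ℂ).im = 0 := inner_self_im (𝕜 := ℂ) x
  have h2 : (inner ℂ y y : ℂ).im = 0 := inner_self_im (𝕜 := ℂ) y
  simp only [inner_add_left, inner_sub_right, Complex.add_im, Complex.sub_im, h, h1, h2, h3]
  simp

/-- Off `S` the difference is just `x`, and on `S` the mass of `x` falls short of `‖y‖₁` by at most
the mass of the difference there. As `x` has no more total mass than `y`, its tail can only fill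
that shortfall. -/
lemma l1norm_tail_le {S : Finset (Fin d)} {x y : EuclideanSpace ℂ (Fin d)} (hy : SupportedOn S y)
    (hxy : l1norm x ≤ l1norm y) :
    l1norm ((x - y) - restrictTo S (x - y)) ≤ l1norm (restrictTo S (x - y)) := by
  have e : (x - y) - restrictTo S (x - y) = x - restrictTo S x := by
    rw [restrictTo_sub, hy.restrictTo_eq]; abel
  have h1 := l1norm_eq_add S x
  have h2 : l1norm y ≤ l1norm (restrictTo S (x - y)) + l1norm (restrictTo S x) := by
    rw [← hy.restrictTo_eq, l1norm_restrictTo, hy.restrictTo_eq, l1norm_restrictTo,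
      l1norm_restrictTo, ← Finset.sum_add_distrib]
    refine Finset.sum_le_sum fun i _ => ?_
    have := norm_sub_le (x i) ((x - y) i)
    simp only [PiLp.sub_apply, sub_sub_cancel] at this ⊢
    linarith
  rw [e]; linarith

/-- Split `x ± y` into parts `ub`, `vb` on a set of `(n + 1) s` indices and a common tail `r` with
`‖r‖ ≤ ‖vb‖ / √n`. `SparseLower` handles the main parts, and `hLn` takes `n` so large that the tail
costs at most half of the resulting bound. -/
lemma cone_lower_bound {a : Fin m → EuclideanSpace ℂ (Fin d)} {s n : ℕ} {L c : ℝ} (hs : 1 ≤ s)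
    (hn : 1 ≤ n) (hL0 : 0 ≤ L) (hc : 0 < c) (hLn : 3 * L ^ 2 ≤ c / 2 * √(n : ℝ))
    (hU : SparseUpper a ((n + 1) * s) L) (hl : SparseLower a ((n + 1) * s) c)
    {S : Finset (Fin d)} (hS : S.card ≤ s) {x y : EuclideanSpace ℂ (Fin d)} (hy : SupportedOn S y)
    (hxy : l1norm x ≤ l1norm y) (him : (inner ℂ x y : ℂ).im = 0) (hre : 0 ≤ (inner ℂ x y : ℂ).re) :
    c / 4 * m * (‖x - y‖ * ‖y‖) ≤ ∑ j, |crossTerm (a j) (x + y) (x - y)| ∧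
    c / 8 * m * ‖x - y‖ ^ 2 ≤ ∑ j, |crossTerm (a j) (x + y) (x - y)| := by
  have hsR : (0 : ℝ) < s := by exact_mod_cast hs
  have hnR : (1 : ℝ) ≤ n := by exact_mod_cast hn
  have hsn : 1 ≤ √(n : ℝ) := Real.one_le_sqrt.2 hnR
  set v := x - y with hv
  set w := v - restrictTo S v with hw
  obtain ⟨T, hT, hblock⟩ := exists_restrictTo_tail (k := n * s) (by positivity) w
  set V := S ∪ T with hV
  have hVc : V.card ≤ (n + 1) * s := (Finset.card_union_le _ _).trans (by linarith)
  set vb := restrictTo V v with hvb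
  set ub := restrictTo V (x + y) with hub
  set r := w - restrictTo T w with hr
  have hyV : SupportedOn V y := hy.mono Finset.subset_union_left
  have hvr : v = vb + r := by
    ext i
    by_cases hiS : i ∈ S <;> by_cases hiT : i ∈ T <;> simp [hvb, hr, hw, hV, hiS, hiT]
  have hxV : restrictTo V x = vb + y := by
    rw [hvb, hv, restrictTo_sub, hyV.restrictTo_eq]; abel
  have hubx : ub = restrictTo V x + y := by rw [hub, restrictTo_add, hyV.restrictTo_eq]
  have hvbx : vb = restrictTo V x - y := by rw [hxV]; abel
  -- Outside `V` the vector `y` vanishes, so `x + y` and `x - y` coincide there and share the tail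
  -- `r`.
  have hur : x + y = ub + r := by
    have : x = v + y := by rw [hv]; abel
    rw [hubx, hxV, this, hvr]; abel
  have hwl : l1norm w / √((n * s : ℕ) : ℝ) ≤ ‖vb‖ / √(n : ℝ) := by
    have h1 : l1norm w ≤ √(s : ℝ) * ‖vb‖ := by
      refine (l1norm_tail_le hy hxy).trans ((l1norm_restrictTo_le S v).trans ?_)
      have := norm_restrictTo_le_of_subset (Finset.subset_union_left : S ⊆ S ∪ T) v
      have hS' : (S.card : ℝ) ≤ s := by exact_mod_cast hS
      gcongr
    have hss : 0 < √(s : ℝ) := Real.sqrt_pos.2 hsR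
    rw [Nat.cast_mul, Real.sqrt_mul (by positivity), div_le_div_iff₀ (by positivity) (by positivity)]
    calc l1norm w * √(n : ℝ) ≤ √(s : ℝ) * ‖vb‖ * √(n : ℝ) := by gcongr
      _ = _ := by ring
  have hrn : ‖r‖ ≤ ‖vb‖ / √(n : ℝ) := by
    have := hblock (fun z => ‖z‖) 1 zero_le_one (fun y z => norm_add_le y z)
      (fun _ _ z _ => by simp)
    rw [one_mul] at this
    exact this.trans hwl
  have hnK : n * s ≤ (n + 1) * s := Nat.mul_le_mul_right _ (Nat.le_succ _)
  have hAr : ‖measMap a r‖ ≤ L * √(m : ℝ) * (‖vb‖ / √(n : ℝ)) := by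
    refine (hblock (fun z => ‖measMap a z‖) (L * √(m : ℝ)) (by positivity)
      (fun y z => by simpa only [map_add] using norm_add_le _ _)
      (fun S hS z hz => hU S (hS.trans hnK) z hz)).trans ?_
    gcongr
  have hAu : ‖measMap a ub‖ ≤ L * √(m : ℝ) * ‖ub‖ := hU V hVc _ (supportedOn_restrictTo _ _)
  have hAv : ‖measMap a vb‖ ≤ L * √(m : ℝ) * ‖vb‖ := hU V hVc _ (supportedOn_restrictTo _ _)
  have hin : inner ℂ (restrictTo V x) y = inner ℂ x y := inner_restrictTo_left x hyV
  -- Restricting `x` to `V` leaves its inner product with `y` unchanged, so `‖ub‖² - ‖vb‖² = 4 Re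
  -- ⟨x, y⟩ ≥ 0`.
  have huv : ‖vb‖ ≤ ‖ub‖ := by
    refine le_of_sq_le_sq ?_ (norm_nonneg _)
    have := norm_add_sq_sub_norm_sub_sq (restrictTo V x) y
    rw [← hubx, ← hvbx, hin] at this
    linarith
  have hlow := hl V hVc ub vb (supportedOn_restrictTo _ _) (supportedOn_restrictTo _ _) (by
    rw [hubx, hvbx]; exact inner_add_sub_im _ _ (by rw [hin, him]))
  have hpert := sum_abs_crossTerm_le_add a ub vb r r
  rw [← hur, ← hvr] at hpert
  have hmm : √(m : ℝ) * √(m : ℝ) = m := Real.mul_self_sqrt (by positivity)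
  -- Each of the three terms is at most `L² m ‖ub‖ ‖vb‖ / √n`.
  have herr : ‖measMap a ub‖ * ‖measMap a r‖ + ‖measMap a r‖ * ‖measMap a vb‖ +
      ‖measMap a r‖ * ‖measMap a r‖ ≤ c / 2 * m * (‖ub‖ * ‖vb‖) := by
    set ν := ‖vb‖ / √(n : ℝ) with hν
    have hν0 : 0 ≤ ν := by positivity
    have hνu : ν ≤ ‖ub‖ := (div_le_self (norm_nonneg _) hsn).trans huv
    calc _ ≤ (L * √(m : ℝ) * ‖ub‖) * (L * √(m : ℝ) * ν) + (L * √(m : ℝ) * ν) * (L * √(m : ℝ) * ‖vb‖)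
          + (L * √(m : ℝ) * ν) * (L * √(m : ℝ) * ν) := by gcongr
      _ ≤ (L * √(m : ℝ) * ‖ub‖) * (L * √(m : ℝ) * ν) + (L * √(m : ℝ) * ν) * (L * √(m : ℝ) * ‖ub‖)
          + (L * √(m : ℝ) * ν) * (L * √(m : ℝ) * ‖ub‖) := by gcongr
      _ = 3 * L ^ 2 * (√(m : ℝ) * √(m : ℝ)) * (‖ub‖ * ν) := by ring
      _ = 3 * L ^ 2 * m * (‖ub‖ * ν) := by rw [hmm]
      _ ≤ c / 2 * √(n : ℝ) * m * (‖ub‖ * ν) := by gcongr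
      _ = c / 2 * m * (‖ub‖ * (ν * √(n : ℝ))) := by ring
      _ = _ := by rw [hν, div_mul_cancel₀ _ (by positivity)]
  have hmain : c / 2 * m * (‖ub‖ * ‖vb‖) ≤ ∑ j, |crossTerm (a j) (x + y) v| := by linarith
  have hv2 : ‖v‖ ≤ 2 * ‖vb‖ := by
    have h1 : ‖v‖ ≤ ‖vb‖ + ‖r‖ := by
      conv_lhs => rw [hvr]
      exact norm_add_le _ _
    have h2 : ‖vb‖ / √(n : ℝ) ≤ ‖vb‖ := div_le_self (norm_nonneg _) hsn
    linarith
  have hyu : ‖y‖ ≤ ‖ub‖ := by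
    have h1 : (2 : ℝ) * ‖y‖ = ‖ub - vb‖ := by
      rw [hubx, hvbx, show restrictTo V x + y - (restrictTo V x - y) = (2 : ℝ) • y by
        rw [two_smul]; abel, norm_smul]
      simp
    have := norm_sub_le ub vb
    linarith
  constructor
  · refine le_trans ?_ hmain
    calc c / 4 * m * (‖v‖ * ‖y‖) ≤ c / 4 * m * ((2 * ‖vb‖) * ‖ub‖) := by gcongr
      _ = _ := by ring
  · refine le_trans ?_ hmain
    calc c / 8 * m * ‖v‖ ^ 2 ≤ c / 8 * m * (2 * ‖vb‖) ^ 2 := by gcongr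
      _ = c / 2 * m * (‖vb‖ * ‖vb‖) := by ring
      _ ≤ _ := by gcongr

lemma exists_phase (z : ℂ) : ∃ θ ∈ Set.Ico (0 : ℝ) (2 * Real.pi),
    Complex.exp (Complex.I * (θ : ℂ)) * z = (‖z‖ : ℂ) := by
  have key : ∀ θ : ℝ, Complex.exp (Complex.I * (θ : ℂ)) = Complex.exp (-(z.arg * Complex.I)) →
      Complex.exp (Complex.I * (θ : ℂ)) * z = (‖z‖ : ℂ) := fun θ h => by
    have h1 : Complex.exp (-(z.arg * Complex.I)) * Complex.exp (z.arg * Complex.I) = 1 := by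
      rw [← Complex.exp_add, neg_add_cancel, Complex.exp_zero]
    have h2 := Complex.norm_mul_exp_arg_mul_I z
    rw [h]
    linear_combination (‖z‖ : ℂ) * h1 - Complex.exp (-(z.arg * Complex.I)) * h2
  have h1 := Complex.neg_pi_lt_arg z
  have h2 := Complex.arg_le_pi z
  have hp := Real.pi_pos
  by_cases h : z.arg ≤ 0
  · refine ⟨-z.arg, ⟨by linarith, by linarith⟩, key _ ?_⟩
    congr 1; push_cast; ring
  · push Not at h
    refine ⟨2 * Real.pi - z.arg, ⟨by linarith, by linarith⟩, key _ ?_⟩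
    have : Complex.I * ((2 * Real.pi - z.arg : ℝ) : ℂ) =
        -(z.arg * Complex.I) + 2 * Real.pi * Complex.I := by push_cast; ring
    rw [this, Complex.exp_add, Complex.exp_two_pi_mul_I, mul_one]

lemma sum_abs_le_of_norm_sub_le {m : ℕ} {q η : EuclideanSpace ℝ (Fin m)} (h : ‖q - η‖ ≤ ‖η‖) :
    ∑ j, |q j| ≤ 2 * √(m : ℝ) * ‖η‖ := by
  have h1 : ‖q‖ ≤ 2 * ‖η‖ := by
    have := norm_add_le (q - η) η
    rw [sub_add_cancel] at this
    linarith
  have h2 : ∑ j, |q j| ≤ √(m : ℝ) * ‖q‖ := by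
    have := Real.sum_mul_le_sqrt_mul_sqrt Finset.univ (fun _ : Fin m => (1 : ℝ)) (fun j => |q j|)
    simpa [EuclideanSpace.norm_eq] using this
  calc _ ≤ √(m : ℝ) * ‖q‖ := h2
    _ ≤ √(m : ℝ) * (2 * ‖η‖) := by gcongr
    _ = _ := by ring

/-- Optimality against the feasible point `x₀`, whose loss is `‖η‖²`, reads `‖q - η‖ ≤ ‖η‖`; the
triangle inequality and Cauchy–Schwarz turn this into an `ℓ¹` bound. -/
lemma sum_abs_sub_le_of_isSolution {a : Fin m → EuclideanSpace ℂ (Fin d)}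
    {x₀ xhat : EuclideanSpace ℂ (Fin d)} {η : EuclideanSpace ℝ (Fin m)}
    (h : IsSolution a (intensity a x₀ η) (l1norm x₀) xhat) :
    ∑ j, |‖inner ℂ (a j) xhat‖ ^ 2 - ‖inner ℂ (a j) x₀‖ ^ 2| ≤ 2 * √(m : ℝ) * ‖η‖ := by
  set q : EuclideanSpace ℝ (Fin m) := WithLp.toLp 2
    (fun j => ‖inner ℂ (a j) xhat‖ ^ 2 - ‖inner ℂ (a j) x₀‖ ^ 2) with hq
  have hmin : intensityLoss a (intensity a x₀ η) xhat ≤ intensityLoss a (intensity a x₀ η) x₀ :=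
    h.2 (le_refl (l1norm x₀))
  refine sum_abs_le_of_norm_sub_le (q := q) ?_
  rw [EuclideanSpace.norm_eq, EuclideanSpace.norm_eq]
  refine Real.sqrt_le_sqrt ?_
  simp only [Real.norm_eq_abs, sq_abs]
  simp only [intensityLoss, intensity, sub_add_cancel_left, neg_sq] at hmin
  simpa [hq, sub_sub] using hmin

theorem phaseDist_le_of_sparse_bounds {a : Fin m → EuclideanSpace ℂ (Fin d)} {s n : ℕ} {L c : ℝ}
    (hm : 0 < m) (hs : 1 ≤ s)
    (hn : 1 ≤ n) (hL0 : 0 ≤ L) (hc : 0 < c) (hLn : 3 * L ^ 2 ≤ c / 2 * √(n : ℝ))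
    (hU : SparseUpper a ((n + 1) * s) L) (hl : SparseLower a ((n + 1) * s) c)
    {x₀ xhat : EuclideanSpace ℂ (Fin d)} {η : EuclideanSpace ℝ (Fin m)} (hx₀ : IsSparse s x₀)
    (h : IsSolution a (intensity a x₀ η) (l1norm x₀) xhat) :
    phaseDist xhat x₀ ≤ (8 / c + 4 / √c) *
      min (√‖η‖ / (m : ℝ) ^ (1 / 4 : ℝ)) (‖η‖ / (‖x₀‖ * √(m : ℝ))) := by
  have hmR : (0 : ℝ) < m := by exact_mod_cast hm
  obtain ⟨θ, hθ, hph⟩ := exists_phase (inner ℂ xhat x₀)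
  set y := Complex.exp (Complex.I * (θ : ℂ)) • x₀ with hy
  have hexp : ‖Complex.exp (Complex.I * (θ : ℂ))‖ = 1 := by
    rw [mul_comm]; exact Complex.norm_exp_ofReal_mul_I θ
  obtain ⟨-, -, -, hle⟩ := phaseDist_attained xhat x₀
  have hD := hle θ hθ
  rw [← hy] at hD
  have hyn : ‖y‖ = ‖x₀‖ := by rw [hy, norm_smul, hexp, one_mul]
  have hyl : l1norm y = l1norm x₀ := by simp [l1norm, hy, hexp]
  have hin : inner ℂ xhat y = (‖(inner ℂ xhat x₀ : ℂ)‖ : ℂ) := by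
    rw [hy, inner_smul_right, hph]
  have hyj : ∀ j, ‖inner ℂ (a j) y‖ = ‖inner ℂ (a j) x₀‖ := fun j => by
    rw [hy, inner_smul_right, norm_mul, hexp, one_mul]
  classical
  have hSc : ({i | x₀ i ≠ 0} : Finset (Fin d)).card ≤ s := by
    have := hx₀
    rw [IsSparse, Set.ncard_eq_toFinset_card'] at this
    simpa using this
  have hyS : SupportedOn ({i | x₀ i ≠ 0} : Finset (Fin d)) y := fun i hi => by
    have : x₀ i = 0 := by simpa using hi
    simp [hy, this]
  obtain ⟨h1, h2⟩ := cone_lower_bound hs hn hL0 hc hLn hU hl hSc hyS (h.1.trans hyl.ge)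
    (by rw [hin, Complex.ofReal_im]) (by rw [hin, Complex.ofReal_re]; positivity)
  have hF : ∑ j, |crossTerm (a j) (xhat + y) (xhat - y)| ≤ 2 * √(m : ℝ) * ‖η‖ := by
    simp only [crossTerm_add_sub, hyj]
    exact sum_abs_sub_le_of_isSolution h
  set D := ‖xhat - y‖ with hDdef
  have hD0 : 0 ≤ D := norm_nonneg _
  have hsm : 0 < √(m : ℝ) := Real.sqrt_pos.2 hmR
  have hmm : √(m : ℝ) * √(m : ℝ) = m := Real.mul_self_sqrt hmR.le
  have hsc : 0 < √c := Real.sqrt_pos.2 hc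
  have g1 : √(m : ℝ) * (D * ‖x₀‖) ≤ 8 / c * ‖η‖ := by
    rw [hyn] at h1
    have h3 : c / 4 * (√(m : ℝ) * √(m : ℝ)) * (D * ‖x₀‖) ≤ 2 * √(m : ℝ) * ‖η‖ := by
      rw [hmm]; exact h1.trans hF
    rw [div_mul_eq_mul_div, le_div_iff₀ hc]
    refine le_of_mul_le_mul_left ?_ hsm
    linarith
  have g2 : D ^ 2 ≤ (4 / √c) ^ 2 * (‖η‖ / √(m : ℝ)) := by
    have h3 : c / 8 * (√(m : ℝ) * √(m : ℝ)) * D ^ 2 ≤ 2 * √(m : ℝ) * ‖η‖ := by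
      rw [hmm]; exact h2.trans hF
    rw [div_pow, Real.sq_sqrt hc.le, div_mul_div_comm, le_div_iff₀ (by positivity)]
    refine le_of_mul_le_mul_left ?_ hsm
    linarith
  refine hD.trans ?_
  rw [mul_min_of_nonneg _ _ (by positivity)]
  refine le_min ?_ ?_
  · have h4 : D ≤ 4 / √c * (√‖η‖ / (m : ℝ) ^ (1 / 4 : ℝ)) := by
      refine le_of_sq_le_sq ?_ (by positivity)
      refine g2.trans (le_of_eq ?_)
      rw [mul_pow, div_pow (√‖η‖), Real.sq_sqrt (norm_nonneg _)]
      congr 2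
      rw [← Real.rpow_natCast, ← Real.rpow_mul hmR.le, Real.sqrt_eq_rpow]
      norm_num
    refine h4.trans ?_
    gcongr
    have : 0 < 8 / c := by positivity
    linarith
  · rcases eq_or_ne x₀ 0 with rfl | hx
    -- For `x₀ = 0` division by zero makes the right-hand side `0`, so equality `xhat = y` is
    -- needed; it comes from the constraint `‖xhat‖₁ ≤ 0`.
    · have hy0 : y = 0 := by rw [hy, smul_zero]
      have hl0 : l1norm xhat ≤ 0 := h.1.trans (by simp [l1norm])
      have hxh : xhat = 0 := by
        ext i
        have h5 := (Finset.sum_eq_zero_iff_of_nonneg (fun i _ => norm_nonneg (xhat i))).1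
          (le_antisymm hl0 (l1norm_nonneg _)) i (Finset.mem_univ _)
        simpa using h5
      rw [hDdef, hy0, hxh]
      simp
    · have hx' : 0 < ‖x₀‖ := norm_pos_iff.2 hx
      have h4 : D ≤ 8 / c * (‖η‖ / (‖x₀‖ * √(m : ℝ))) := by
        rw [← mul_div_assoc, le_div_iff₀ (by positivity)]
        linarith
      refine h4.trans ?_
      gcongr
      have : 0 < 4 / √c := by positivity
      linarith

end Deterministic

/-! ### Nets of the sparse unit ball. -/

section Nets

/-- A 1-separated subset of the ball of radius 2 has at most `5 ^ dim` points by volume comparison,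
and one of maximal cardinality is a net. -/
lemma exists_half_net (E : Type*) [NormedAddCommGroup E] [NormedSpace ℝ E]
    [FiniteDimensional ℝ E] :
    ∃ N : Finset E, N.card ≤ 5 ^ Module.finrank ℝ E ∧
      ∀ x, ‖x‖ ≤ 2 → ∃ y ∈ N, ‖x - y‖ ≤ 1 := by
  classical
  let P : ℕ → Prop := fun n => ∃ N : Finset E, N.card = n ∧ (∀ c ∈ N, ‖c‖ ≤ 2) ∧
    ∀ c ∈ N, ∀ d ∈ N, c ≠ d → 1 ≤ ‖c - d‖
  have hP : ∀ n, P n → n ≤ 5 ^ Module.finrank ℝ E := by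
    rintro n ⟨N, rfl, h1, h2⟩
    exact Besicovitch.card_le_of_separated N h1 h2
  have hP0 : P 0 := ⟨∅, by simp⟩
  obtain ⟨N, hN, h1, h2⟩ := Nat.findGreatest_spec (P := P) (Nat.zero_le (5 ^ Module.finrank ℝ E)) hP0
  refine ⟨N, hP _ ⟨N, rfl, h1, h2⟩, fun x hx => ?_⟩
  by_contra! hcon
  have hxN : x ∉ N := fun h => by
    have := hcon x h
    rw [sub_self, norm_zero] at this
    linarith
  have hbig : P (N.card + 1) := by
    refine ⟨insert x N, Finset.card_insert_of_notMem hxN, ?_, ?_⟩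
    · intro c hc
      rcases Finset.mem_insert.1 hc with rfl | hc
      exacts [hx, h1 c hc]
    · intro c hc e he hce
      rcases Finset.mem_insert.1 hc with rfl | hc' <;>
        rcases Finset.mem_insert.1 he with rfl | he'
      · exact absurd rfl hce
      · exact (hcon e he').le
      · rw [norm_sub_rev]; exact (hcon c hc').le
      · exact h2 c hc' e he' hce
  have := Nat.le_findGreatest (hP _ hbig) hbig
  omega

/-- Each halving of the radius covers the rescaled error by the same half net, at the cost of a
factor `5 ^ dim`. -/
lemma exists_dyadic_net (E : Type*) [NormedAddCommGroup E] [NormedSpace ℝ E]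
    [FiniteDimensional ℝ E] (l : ℕ) :
    ∃ N : Finset E, N.card ≤ 5 ^ (l * Module.finrank ℝ E) ∧
      ∀ x, ‖x‖ ≤ 1 → ∃ y ∈ N, ‖x - y‖ ≤ (1 / 2) ^ l := by
  classical
  obtain ⟨M, hM, hM'⟩ := exists_half_net E
  induction l with
  | zero => exact ⟨{0}, by simp, fun x hx => ⟨0, by simp, by simpa using hx⟩⟩
  | succ l ih =>
    obtain ⟨N, hN, hN'⟩ := ih
    refine ⟨Finset.image₂ (fun y z => y + ((1 / 2 : ℝ) ^ (l + 1)) • z) N M, ?_, fun x hx => ?_⟩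
    · refine (Finset.card_image₂_le _ _ _).trans ?_
      rw [add_mul, one_mul, pow_add]
      gcongr
    · obtain ⟨y, hy, hxy⟩ := hN' x hx
      obtain ⟨z, hz, hz'⟩ := hM' ((2 : ℝ) ^ (l + 1) • (x - y)) (by
        rw [norm_smul, Real.norm_of_nonneg (by positivity)]
        calc (2 : ℝ) ^ (l + 1) * ‖x - y‖ ≤ 2 ^ (l + 1) * (1 / 2) ^ l := by gcongr
          _ = 2 := by rw [pow_succ, one_div, inv_pow]; field_simp)
      refine ⟨_, Finset.mem_image₂_of_mem hy hz, ?_⟩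
      have e : x - (y + (1 / 2 : ℝ) ^ (l + 1) • z) =
          ((1 / 2 : ℝ) ^ (l + 1)) • ((2 : ℝ) ^ (l + 1) • (x - y) - z) := by
        rw [smul_sub, smul_smul, ← mul_pow]
        norm_num
        abel
      rw [e, norm_smul, Real.norm_of_nonneg (by positivity)]
      exact mul_le_of_le_one_right (by positivity) hz'

variable {d : ℕ}

lemma exists_net_supportedOn (T : Finset (Fin d)) (l : ℕ) :
    ∃ N : Finset (EuclideanSpace ℂ (Fin d)), N.card ≤ 5 ^ (l * (2 * T.card)) ∧
      (∀ y ∈ N, SupportedOn T y) ∧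
      ∀ x, SupportedOn T x → ‖x‖ ≤ 1 → ∃ y ∈ N, ‖x - y‖ ≤ (1 / 2) ^ l := by
  classical
  obtain ⟨N, hN, hN'⟩ := exists_dyadic_net (EuclideanSpace ℂ T) l
  let ι : EuclideanSpace ℂ T → EuclideanSpace ℂ (Fin d) := fun z =>
    WithLp.toLp 2 (fun i => if h : i ∈ T then z ⟨i, h⟩ else 0)
  have hι : ∀ z, ‖ι z‖ = ‖z‖ := fun z => by
    rw [EuclideanSpace.norm_eq, EuclideanSpace.norm_eq, ← Finset.sum_subset (Finset.subset_univ T),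
      ← Finset.sum_coe_sort T]
    · simp [ι]
    · intro i _ hi; simp [ι, hi]
  have hfr : Module.finrank ℝ (EuclideanSpace ℂ T) = 2 * T.card := by
    rw [← Module.finrank_mul_finrank ℝ ℂ (EuclideanSpace ℂ T), Complex.finrank_real_complex]
    simp
  rw [hfr] at hN
  refine ⟨N.image ι, Finset.card_image_le.trans hN, ?_, fun x hx hx1 => ?_⟩
  · intro y hy i hi
    obtain ⟨z, -, rfl⟩ := Finset.mem_image.1 hy
    simp [ι, hi]
  · let x' : EuclideanSpace ℂ T := WithLp.toLp 2 (fun i => x i)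
    have hxx : ι x' = x := by
      ext i
      by_cases hi : i ∈ T
      · simp [ι, x', hi]
      · simp [ι, hi, hx i hi]
    obtain ⟨z, hz, hz'⟩ := hN' x' (by rw [← hι, hxx]; exact hx1)
    refine ⟨ι z, Finset.mem_image_of_mem _ hz, ?_⟩
    have : ι x' - ι z = ι (x' - z) := by
      ext i; by_cases hi : i ∈ T <;> simp [ι, hi]
    rwa [← hxx, this, hι]

/-- The number of subsets of size at most `k` of a `d`-element set, with a free parameter. -/
lemma card_filter_card_le_mul_pow (d k : ℕ) {t : ℝ} (ht : 0 < t) (ht1 : t ≤ 1) :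
    (({T : Finset (Fin d) | T.card ≤ k} : Finset _).card : ℝ) * t ^ k ≤ Real.exp (t * d) := by
  calc (({T : Finset (Fin d) | T.card ≤ k} : Finset _).card : ℝ) * t ^ k
      = ∑ T ∈ ({T : Finset (Fin d) | T.card ≤ k} : Finset _), t ^ k := by simp
    _ ≤ ∑ T ∈ ({T : Finset (Fin d) | T.card ≤ k} : Finset _), t ^ T.card := by
        refine Finset.sum_le_sum fun T hT => ?_
        exact pow_le_pow_of_le_one ht.le ht1 (by simpa using hT)
    _ ≤ ∑ T : Finset (Fin d), t ^ T.card :=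
        Finset.sum_le_sum_of_subset_of_nonneg (Finset.subset_univ _) fun _ _ _ => by positivity
    _ = (t + 1) ^ d := by
        have := Fintype.sum_pow_mul_eq_add_pow (Fin d) t 1
        simpa using this
    _ ≤ Real.exp t ^ d := by gcongr; exact Real.add_one_le_exp t
    _ = Real.exp (t * d) := by rw [← Real.exp_nat_mul, mul_comm]

/-- A net of the sparse unit ball that respects supports. -/
lemma exists_sparse_net {s : ℕ} (hs : 1 ≤ s) (hsd : s ≤ d) {q : ℕ} (hq : 1 ≤ q) (l : ℕ) :
    ∃ N : Finset (EuclideanSpace ℂ (Fin d)),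
      (N.card : ℝ) ≤ Real.exp (q * (1 + 4 * l) * (s * Real.log (Real.exp 1 * d / s))) ∧
      ∀ T : Finset (Fin d), T.card ≤ q * s → ∀ x, SupportedOn T x → ‖x‖ ≤ 1 →
        ∃ y ∈ N, SupportedOn T y ∧ ‖x - y‖ ≤ (1 / 2) ^ l := by
  classical
  choose N hN hNs hN' using fun T : Finset (Fin d) => exists_net_supportedOn T l
  refine ⟨({T : Finset (Fin d) | T.card ≤ q * s} : Finset _).biUnion N, ?_, ?_⟩
  · have hsR : (0 : ℝ) < s := by exact_mod_cast hs
    have hsdR : (s : ℝ) ≤ d := by exact_mod_cast hsd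
    have hdR : (0 : ℝ) < d := hsR.trans_le hsdR
    have hqR : (1 : ℝ) ≤ q := by exact_mod_cast hq
    set Λ := Real.log (Real.exp 1 * d / s) with hΛ
    have hΛe : Λ = 1 + Real.log (d / s) := by
      rw [hΛ, mul_div_assoc, Real.log_mul (by positivity) (by positivity), Real.log_exp]
    have hlog : 0 ≤ Real.log (d / s) := Real.log_nonneg ((one_le_div hsR).2 hsdR)
    have hcount : (({T : Finset (Fin d) | T.card ≤ q * s} : Finset _).card : ℝ) ≤
        Real.exp (q * (s * Λ)) := by
      -- The choice `t = s / d` makes `exp (t d) = exp s`, while `t ^ (-q s)` gives `exp (q s log (d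
      -- / s))`.
      have h := card_filter_card_le_mul_pow d (q * s) (t := s / d) (by positivity)
        ((div_le_one hdR).2 hsdR)
      rw [div_mul_cancel₀ _ hdR.ne'] at h
      have h2 : ((s : ℝ) / d) ^ (q * s) = Real.exp (-(q * s * Real.log (d / s))) := by
        rw [← Real.exp_log (show (0 : ℝ) < (s : ℝ) / d by positivity), ← Real.exp_nat_mul,
          show (s : ℝ) / d = ((d : ℝ) / s)⁻¹ by rw [inv_div], Real.log_inv]
        push_cast; ring_nf
      rw [h2, Real.exp_neg, ← div_eq_mul_inv, div_le_iff₀ (Real.exp_pos _), ← Real.exp_add] at h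
      refine h.trans (Real.exp_le_exp.2 ?_)
      rw [hΛe]
      nlinarith
    have hcard : ((({T : Finset (Fin d) | T.card ≤ q * s} : Finset _).biUnion N).card : ℝ) ≤
        (({T : Finset (Fin d) | T.card ≤ q * s} : Finset _).card : ℝ) *
          (5 : ℝ) ^ (l * (2 * (q * s))) := by
      have := Finset.card_biUnion_le_card_mul ({T : Finset (Fin d) | T.card ≤ q * s} : Finset _) N
        (5 ^ (l * (2 * (q * s)))) (fun T hT => (hN T).trans (by
          have : T.card ≤ q * s := by simpa using hT
          gcongr; norm_num))
      exact_mod_cast this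
    have h5 : (5 : ℝ) ^ (l * (2 * (q * s))) ≤ Real.exp (4 * l * q * (s * Λ)) := by
      have he : (5 : ℝ) ≤ Real.exp 2 := by
        have := Real.exp_one_gt_d9
        rw [show (2 : ℝ) = 1 + 1 by norm_num, Real.exp_add]
        nlinarith
      calc (5 : ℝ) ^ (l * (2 * (q * s))) ≤ Real.exp 2 ^ (l * (2 * (q * s))) := by gcongr
        _ = Real.exp (4 * l * q * s) := by rw [← Real.exp_nat_mul]; push_cast; ring_nf
        _ ≤ _ := by
          refine Real.exp_le_exp.2 ?_
          have : (s : ℝ) ≤ s * Λ := le_mul_of_one_le_right hsR.le (by rw [hΛe]; linarith)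
          calc (4 * l * q * s : ℝ) ≤ 4 * l * q * (s * Λ) := by gcongr
            _ = _ := by ring
    calc _ ≤ _ := hcard
      _ ≤ Real.exp (q * (s * Λ)) * Real.exp (4 * l * q * (s * Λ)) := by gcongr
      _ = _ := by rw [← Real.exp_add]; ring_nf
  · intro T hT x hx hx1
    obtain ⟨y, hy, hxy⟩ := hN' T x hx hx1
    exact ⟨y, Finset.mem_biUnion.2 ⟨T, by simpa using hT, hy⟩, hNs T y hy, hxy⟩

end Nets

/-! ### Gaussian marginals and the small-ball estimate. -/

section Gaussian

variable {d : ℕ}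

lemma re_inner_complexGaussian_aux (z : EuclideanSpace ℂ (Fin d))
    (p : EuclideanSpace ℝ (Fin d) × EuclideanSpace ℝ (Fin d)) :
    (inner ℂ (WithLp.toLp 2 (fun i => ((1 / √2 : ℝ) : ℂ) * (p.1 i : ℂ) +
      Complex.I * ((1 / √2 : ℝ) : ℂ) * (p.2 i : ℂ)) : EuclideanSpace ℂ (Fin d)) z : ℂ).re =
    inner ℝ p.1 (WithLp.toLp 2 (fun i => 1 / √2 * (z i).re) : EuclideanSpace ℝ (Fin d)) +
    inner ℝ p.2 (WithLp.toLp 2 (fun i => 1 / √2 * (z i).im) : EuclideanSpace ℝ (Fin d)) := by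
  simp only [PiLp.inner_apply, Complex.re_sum, ← Finset.sum_add_distrib]
  refine Finset.sum_congr rfl fun i _ => ?_
  simp [-Complex.ofReal_inv]
  ring

lemma integral_cexp_re_inner (z : EuclideanSpace ℂ (Fin d)) :
    ∫ a, Complex.exp (((inner ℂ a z : ℂ).re : ℂ) * Complex.I) ∂(complexGaussian d) =
      Complex.exp (-(‖z‖ ^ 2 / 4 : ℝ)) := by
  rw [complexGaussian, integral_map (by fun_prop) (by fun_prop)]
  simp_rw [re_inner_complexGaussian_aux, Complex.ofReal_add, add_mul, Complex.exp_add]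
  rw [integral_prod_mul (fun x => Complex.exp (((inner ℝ x _ : ℝ) : ℂ) * Complex.I))
    (fun x => Complex.exp (((inner ℝ x _ : ℝ) : ℂ) * Complex.I)),
    ← charFun_apply, ← charFun_apply, charFun_stdGaussian, charFun_stdGaussian, ← Complex.exp_add]
  congr 1
  norm_cast
  simp only [EuclideanSpace.norm_sq_eq, Real.norm_eq_abs, sq_abs, mul_pow, div_pow,
    Real.sq_sqrt (zero_le_two : (0 : ℝ) ≤ 2), Complex.sq_norm, Complex.normSq_apply,
    Finset.sum_add_distrib, ← Finset.mul_sum]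
  simp only [← pow_two]
  ring

lemma map_re_inner_complexGaussian (z : EuclideanSpace ℂ (Fin d)) :
    (complexGaussian d).map (fun a => (inner ℂ a z : ℂ).re) =
      gaussianReal 0 (‖z‖₊ ^ 2 / 2) := by
  have := Measure.isProbabilityMeasure_map (μ := complexGaussian d)
    (f := fun a => (inner ℂ a z : ℂ).re) (by fun_prop)
  refine Measure.ext_of_charFun (funext fun t => ?_)
  rw [charFun_apply_real, integral_map (by fun_prop) (by fun_prop), charFun_gaussianReal]
  have h := integral_cexp_re_inner ((t : ℂ) • z)
  simp only [inner_smul_right, Complex.re_ofReal_mul, Complex.ofReal_mul] at h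
  rw [h]
  congr 1
  simp only [norm_smul, Complex.norm_real, mul_pow, Real.norm_eq_abs, sq_abs]
  push_cast
  simp
  ring

/-- The joint characteristic function depends only on `‖∑ t_i z_i‖²`, which splits into a sum as
soon as the real parts of the inner products vanish. -/
lemma iIndepFun_re_inner {ι : Type*} [Fintype ι] (z : ι → EuclideanSpace ℂ (Fin d))
    (hz : ∀ i j, i ≠ j → (inner ℂ (z i) (z j) : ℂ).re = 0) :
    iIndepFun (fun i a => (inner ℂ a (z i) : ℂ).re) (complexGaussian d) := by
  classical
  rw [iIndepFun_iff_charFun_pi (fun i => by fun_prop)]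
  intro t
  simp_rw [map_re_inner_complexGaussian, charFun_gaussianReal]
  rw [charFun_apply, integral_map (by fun_prop) (by fun_prop), ← Complex.exp_sum]
  have h := integral_cexp_re_inner (∑ i, (t i : ℂ) • z i)
  have e : ∀ a : EuclideanSpace ℂ (Fin d), inner ℝ (WithLp.toLp 2
      (fun i => (inner ℂ a (z i) : ℂ).re) : EuclideanSpace ℝ ι) t =
      (inner ℂ a (∑ i, (t i : ℂ) • z i) : ℂ).re := fun a => by
    simp [PiLp.inner_apply]
  simp_rw [e, h]
  have hn : ‖∑ i, (t i : ℂ) • z i‖ ^ 2 = ∑ i, t i ^ 2 * ‖z i‖ ^ 2 := by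
    rw [@norm_sq_eq_re_inner ℂ, sum_inner, map_sum]
    refine Finset.sum_congr rfl fun i _ => ?_
    rw [inner_sum, map_sum, Finset.sum_eq_single i]
    · rw [inner_smul_left, inner_smul_right, inner_self_eq_norm_sq_to_K]
      simp [← Complex.ofReal_pow]
      ring
    · intro j _ hj
      have := hz i j hj.symm
      simp only [inner_smul_left, inner_smul_right, Complex.conj_ofReal, RCLike.re_to_complex,
        Complex.re_ofReal_mul, this, mul_zero]
    · simp
  rw [hn]
  congr 1
  push_cast
  rw [Finset.sum_div, ← Finset.sum_neg_distrib]
  refine Finset.sum_congr rfl fun i _ => ?_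
  simp
  ring

/-- The probability that a centred real Gaussian of variance `1/2` exceeds `1`. -/
def gaussianTail : ℝ := (gaussianReal 0 (1 / 2)).real (Set.Ici 1)

lemma gaussianTail_pos : 0 < gaussianTail := by
  refine ENNReal.toReal_pos (fun h => ?_) (measure_ne_top _ _)
  have := gaussianReal_absolutelyContinuous' 0 (v := 1 / 2) (by norm_num) h
  simp at this

lemma gaussianReal_eq_map (c : NNReal) :
    gaussianReal 0 (c ^ 2 / 2) = (gaussianReal 0 (1 / 2)).map (fun x => (c : ℝ) * x) := by
  rw [gaussianReal_map_const_mul, mul_zero]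
  congr 1
  ext
  simp
  ring

lemma gaussianTail_le (z : EuclideanSpace ℂ (Fin d)) :
    ENNReal.ofReal gaussianTail ≤
      complexGaussian d ((fun a => (inner ℂ a z : ℂ).re) ⁻¹' Set.Ici ‖z‖) := by
  rw [← Measure.map_apply (by fun_prop) measurableSet_Ici, map_re_inner_complexGaussian,
    gaussianReal_eq_map, Measure.map_apply (by fun_prop) measurableSet_Ici, gaussianTail,
    ofReal_measureReal]
  refine measure_mono fun x hx => ?_
  simp only [Set.mem_Ici, Set.mem_preimage, coe_nnnorm] at hx ⊢
  exact le_mul_of_one_le_right (norm_nonneg _) hx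

lemma crossTerm_smul_left (a u v : EuclideanSpace ℂ (Fin d)) (r : ℝ) :
    crossTerm a ((r : ℂ) • u) v = r * crossTerm a u v := by
  simp only [crossTerm, inner_smul_right, mul_assoc, Complex.re_ofReal_mul]

lemma crossTerm_neg_right (a u v : EuclideanSpace ℂ (Fin d)) :
    crossTerm a u (-v) = -crossTerm a u v := by
  simp [crossTerm]

/-- Write `v = α u + w` with `w ⊥ u`. The imaginary part of `α` drops out of the cross term. If the
real and imaginary parts of `⟨a, u⟩` and `⟨a, w⟩`, four independent Gaussians, are at least `1, 1,
‖w‖, ‖w‖`, then all contributions are nonnegative and the cross term is at least `Re α + ‖w‖`. -/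
lemma small_ball_of_norm_eq_one_of_nonneg {u v : EuclideanSpace ℂ (Fin d)} (hu : ‖u‖ = 1)
    (him : |(inner ℂ u v : ℂ).im| ≤ ‖v‖ / 2) (hre : 0 ≤ (inner ℂ u v : ℂ).re) :
    ENNReal.ofReal (gaussianTail ^ 4) ≤ complexGaussian d {a | ‖v‖ / 2 ≤ |crossTerm a u v|} := by
  set α : ℂ := inner ℂ u v with hα
  set w := v - α • u with hw
  have huw : inner ℂ u w = 0 := by
    rw [hw, inner_sub_right, inner_smul_right, inner_self_eq_norm_sq_to_K, hu]
    simp [hα]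
  have hwu : inner ℂ w u = 0 := by rw [← inner_conj_symm, huw, map_zero]
  have hvw : v = α • u + w := by rw [hw]; abel
  have hnorm : ‖v‖ ^ 2 = α.re ^ 2 + α.im ^ 2 + ‖w‖ ^ 2 := by
    have := norm_add_sq_eq_norm_sq_add_norm_sq_of_inner_eq_zero (𝕜 := ℂ) (α • u) w
      (by rw [inner_smul_left, huw, mul_zero])
    rw [← hvw, norm_smul, hu, mul_one] at this
    have h2 := Complex.sq_norm α
    rw [Complex.normSq_apply] at h2
    nlinarith
  -- The factor `-i` makes the real part of the inner product the imaginary part of the original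
  -- one.
  let z : Fin 4 → EuclideanSpace ℂ (Fin d) :=
    ![u, (-Complex.I) • u, w, (-Complex.I) • w]
  have hself : ∀ x : EuclideanSpace ℂ (Fin d), ((‖x‖ : ℂ) ^ 2).im = 0 := fun x => by
    rw [← Complex.ofReal_pow, Complex.ofReal_im]
  have hind := iIndepFun_re_inner z (by
    intro i j hij
    fin_cases i <;> fin_cases j <;>
      simp [z, inner_smul_left, inner_smul_right, huw, hwu, hself] at hij ⊢)
  have hprod := hind.measure_inter_preimage_eq_mul Finset.univ
    (sets := fun i => Set.Ici ‖z i‖) (fun i _ => measurableSet_Ici)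
  calc ENNReal.ofReal (gaussianTail ^ 4) = ∏ i : Fin 4, ENNReal.ofReal gaussianTail := by
        rw [Finset.prod_const, ENNReal.ofReal_pow gaussianTail_pos.le]; simp
    _ ≤ ∏ i, complexGaussian d ((fun a => (inner ℂ a (z i) : ℂ).re) ⁻¹' Set.Ici ‖z i‖) :=
        Finset.prod_le_prod' fun i _ => gaussianTail_le (z i)
    _ = _ := hprod.symm
    _ ≤ _ := by
      refine measure_mono fun a ha => ?_
      simp only [Finset.mem_univ, Set.iInter_true, Set.mem_iInter, Set.mem_preimage,
        Set.mem_Ici] at ha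
      have h0 := ha 0
      have h1 := ha 1
      have h2 := ha 2
      have h3 := ha 3
      simp only [z, Matrix.cons_val, inner_smul_right, norm_smul, norm_neg, Complex.norm_I,
        one_mul, hu] at h0 h1 h2 h3
      simp only [Complex.mul_re, Complex.neg_re, Complex.neg_im, Complex.I_re, Complex.I_im]
        at h1 h3
      have e : crossTerm a u v = α.re * ((inner ℂ a u : ℂ).re ^ 2 + (inner ℂ a u : ℂ).im ^ 2) +
          ((inner ℂ a u : ℂ).re * (inner ℂ a w : ℂ).re +
            (inner ℂ a u : ℂ).im * (inner ℂ a w : ℂ).im) := by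
        rw [hvw, crossTerm, inner_add_right, inner_smul_right]
        simp only [map_add, map_mul, Complex.mul_re, Complex.mul_im, Complex.add_re,
          Complex.add_im, Complex.conj_re, Complex.conj_im]
        ring
      have hw0 := norm_nonneg w
      have hge : α.re + ‖w‖ ≤ crossTerm a u v := by
        rw [e]
        have k1 : α.re * 1 ≤ α.re * ((inner ℂ a u : ℂ).re ^ 2 + (inner ℂ a u : ℂ).im ^ 2) := by
          refine mul_le_mul_of_nonneg_left ?_ hre
          nlinarith [sq_nonneg (inner ℂ a u : ℂ).im]
        have k2 : 1 * ‖w‖ ≤ (inner ℂ a u : ℂ).re * (inner ℂ a w : ℂ).re :=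
          mul_le_mul h0 h2 hw0 (by linarith)
        have k3 : 0 ≤ (inner ℂ a u : ℂ).im * (inner ℂ a w : ℂ).im :=
          mul_nonneg (by linarith) (by linarith)
        linarith
      -- Since `|Im α| ≤ ‖v‖ / 2`, Pythagoras leaves `(Re α)² + ‖w‖² ≥ 3 ‖v‖² / 4`.
      have hsq : (‖v‖ / 2) ^ 2 ≤ (α.re + ‖w‖) ^ 2 := by
        have h4 : α.im ^ 2 ≤ (‖v‖ / 2) ^ 2 := sq_le_sq' (by linarith [neg_abs_le α.im])
          ((le_abs_self _).trans him)
        nlinarith [mul_nonneg hre hw0]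
      exact ((abs_le_of_sq_le_sq' hsq (by positivity)).2.trans hge).trans (le_abs_self _)

/-- An imaginary part of `⟨u, v⟩` is tolerated because net approximations of a pair with real inner
product have only nearly real inner product. The proof rescales `u` and replaces `v` by `-v` if the
real part is negative. -/
lemma small_ball {u v : EuclideanSpace ℂ (Fin d)}
    (him : |(inner ℂ u v : ℂ).im| ≤ ‖u‖ * ‖v‖ / 2) (hu : u ≠ 0) :
    ENNReal.ofReal (gaussianTail ^ 4) ≤
      complexGaussian d {a | ‖u‖ * ‖v‖ / 2 ≤ |crossTerm a u v|} := by
  have hu0 : 0 < ‖u‖ := norm_pos_iff.2 hu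
  have main : ∀ u v : EuclideanSpace ℂ (Fin d), ‖u‖ = 1 → |(inner ℂ u v : ℂ).im| ≤ ‖v‖ / 2 →
      ENNReal.ofReal (gaussianTail ^ 4) ≤
        complexGaussian d {a | ‖v‖ / 2 ≤ |crossTerm a u v|} := fun u v hu him => by
    rcases le_total 0 (inner ℂ u v : ℂ).re with h | h
    · exact small_ball_of_norm_eq_one_of_nonneg hu him h
    · have := small_ball_of_norm_eq_one_of_nonneg (v := -v) hu (by simpa using him)
        (by simpa using h)
      simpa [crossTerm_neg_right] using this
  have h := main (((‖u‖⁻¹ : ℝ) : ℂ) • u) v (by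
    rw [norm_smul, Complex.norm_real, norm_inv, norm_norm, inv_mul_cancel₀ hu0.ne']) (by
    rw [inner_smul_left, Complex.conj_ofReal, Complex.im_ofReal_mul, abs_mul,
      abs_of_pos (inv_pos.2 hu0), inv_mul_le_iff₀ hu0]
    linarith)
  refine h.trans (measure_mono fun a ha => ?_)
  simp only [Set.mem_ofPred_eq, crossTerm_smul_left, abs_mul, abs_of_pos (inv_pos.2 hu0)] at ha ⊢
  rw [le_inv_mul_iff₀ hu0] at ha
  linarith

end Gaussian

/-! ### Exponential tail bounds for a fixed vector or pair. -/

section Tails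

lemma lintegral_pi_prod_eq_pow {E : Type*} [MeasurableSpace E] {γ : Measure E}
    [IsProbabilityMeasure γ] {m : ℕ} {g : E → ENNReal} (hg : Measurable g) :
    ∫⁻ x, ∏ j : Fin m, g (x j) ∂(Measure.pi fun _ : Fin m => γ) = (∫⁻ x, g x ∂γ) ^ m := by
  have hind : iIndepFun (fun (j : Fin m) (x : Fin m → E) => g (x j))
      (Measure.pi fun _ : Fin m => γ) :=
    iIndepFun_pi (X := fun _ : Fin m => g) (fun _ => hg.aemeasurable)
  rw [lintegral_prod_eq_prod_lintegral_of_indepFun Finset.univ _ hind (fun j => by fun_prop)]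
  have h : ∀ j : Fin m, ∫⁻ x, g (x j) ∂(Measure.pi fun _ : Fin m => γ) = ∫⁻ x, g x ∂γ := fun j =>
    (measurePreserving_eval (fun _ : Fin m => γ) j).lintegral_comp hg
  simp [h]

/-- The exponential Markov inequality for a sum over an i.i.d. sample. -/
lemma measure_sum_ge_le {E Ω : Type*} [MeasurableSpace E] [MeasurableSpace Ω] {γ : Measure E}
    {μ : Measure Ω} [IsProbabilityMeasure γ] [IsProbabilityMeasure μ] {m : ℕ} {a : Fin m → Ω → E}
    (ha : ∀ j, HasLaw (a j) γ μ) (hind : iIndepFun a μ) {f : E → ℝ} (hf : Measurable f) (t : ℝ) :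
    μ {ω | t ≤ ∑ j, f (a j ω)} ≤
      ENNReal.ofReal (Real.exp (-t)) * (∫⁻ x, ENNReal.ofReal (Real.exp (f x)) ∂γ) ^ m := by
  have hmap : μ.map (fun ω j => a j ω) = Measure.pi (fun _ => γ) := by
    rw [(iIndepFun_iff_map_fun_eq_pi_map fun j => (ha j).aemeasurable).1 hind]
    simp_rw [(ha _).map_eq]
  have hset : MeasurableSet {x : Fin m → E | t ≤ ∑ j, f (x j)} :=
    measurableSet_le measurable_const (by fun_prop)
  have h1 : μ {ω | t ≤ ∑ j, f (a j ω)} =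
      Measure.pi (fun _ : Fin m => γ) {x | t ≤ ∑ j, f (x j)} := by
    rw [← hmap, Measure.map_apply_of_aemeasurable
      (aemeasurable_pi_lambda _ fun j => (ha j).aemeasurable) hset]
    rfl
  rw [h1, ← lintegral_pi_prod_eq_pow (by fun_prop)]
  have h2 := mul_meas_ge_le_lintegral₀ (μ := Measure.pi (fun _ : Fin m => γ))
    (f := fun x => ∏ j, ENNReal.ofReal (Real.exp (f (x j))))
    (Measurable.aemeasurable (by fun_prop))
    (ENNReal.ofReal (Real.exp t))
  have h3 : {x : Fin m → E | t ≤ ∑ j, f (x j)} ⊆ {x | ENNReal.ofReal (Real.exp t) ≤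
      ∏ j, ENNReal.ofReal (Real.exp (f (x j)))} := fun x hx => by
    simp only [Set.mem_ofPred_eq] at hx ⊢
    rw [← ENNReal.ofReal_prod_of_nonneg (fun _ _ => (Real.exp_pos _).le), ← Real.exp_sum]
    exact ENNReal.ofReal_le_ofReal (Real.exp_le_exp.2 hx)
  have h4 : ENNReal.ofReal (Real.exp (-t)) * ENNReal.ofReal (Real.exp t) = 1 := by
    rw [← ENNReal.ofReal_mul (Real.exp_pos _).le, ← Real.exp_add]
    simp
  calc _ ≤ _ := measure_mono h3
    _ = ENNReal.ofReal (Real.exp (-t)) * (ENNReal.ofReal (Real.exp t) *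
        Measure.pi (fun _ : Fin m => γ) {x | ENNReal.ofReal (Real.exp t) ≤
          ∏ j, ENNReal.ofReal (Real.exp (f (x j)))}) := by rw [← mul_assoc, h4, one_mul]
    _ ≤ _ := by gcongr

/-- A uniform sub-exponential moment bound for the intensities. -/
lemma exists_exp_moment_bound : ∃ C B : ℝ, 0 < C ∧ 0 < B ∧
    ∀ (d : ℕ) (z : EuclideanSpace ℂ (Fin d)), ‖z‖ ≤ 1 →
      ∫⁻ a, ENNReal.ofReal (Real.exp (C * ‖(inner ℂ a z : ℂ)‖ ^ 2)) ∂(complexGaussian d) ≤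
        ENNReal.ofReal B := by
  -- Fernique's theorem in one dimension suffices: the law of `Re ⟨a, z⟩` depends only on `‖z‖`, so
  -- the constants do not see `d`.
  obtain ⟨C, hC, hint⟩ := IsGaussian.exists_integrable_exp_sq (gaussianReal 0 (1 / 2))
  set B := ∫ x, Real.exp (C * ‖x‖ ^ 2) ∂(gaussianReal 0 (1 / 2)) with hB
  have hB0 : 0 < B := integral_exp_pos hint
  refine ⟨C / 2, B, by positivity, hB0, fun d z hz => ?_⟩
  have hone : ∀ w : EuclideanSpace ℂ (Fin d), ‖w‖ ≤ 1 →
      ∫⁻ a, ENNReal.ofReal (Real.exp (C * (inner ℂ a w : ℂ).re ^ 2)) ∂(complexGaussian d) ≤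
        ENNReal.ofReal B := fun w hw => by
    have h1 : ∫⁻ a, ENNReal.ofReal (Real.exp (C * (inner ℂ a w : ℂ).re ^ 2))
        ∂(complexGaussian d) = ∫⁻ x, ENNReal.ofReal (Real.exp (C * x ^ 2))
          ∂((complexGaussian d).map (fun a => (inner ℂ a w : ℂ).re)) := by
      rw [lintegral_map (by fun_prop) (by fun_prop)]
    rw [h1, map_re_inner_complexGaussian, gaussianReal_eq_map,
      lintegral_map (by fun_prop) (by fun_prop), hB,
      ofReal_integral_eq_lintegral_ofReal hint (ae_of_all _ fun _ => (Real.exp_pos _).le)]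
    refine lintegral_mono fun x => ENNReal.ofReal_le_ofReal (Real.exp_le_exp.2 ?_)
    rw [coe_nnnorm, mul_pow, Real.norm_eq_abs, sq_abs]
    have h2 : ‖w‖ ^ 2 ≤ 1 := pow_le_one₀ (norm_nonneg _) hw
    have h3 : ‖w‖ ^ 2 * x ^ 2 ≤ x ^ 2 := mul_le_of_le_one_left (sq_nonneg x) h2
    gcongr
  have hz' : ‖(-Complex.I) • z‖ ≤ 1 := by simpa [norm_smul] using hz
  -- The arithmetic–geometric mean inequality separates the real and imaginary parts at the price of
  -- halving `C`.
  have hpt : ∀ a : EuclideanSpace ℂ (Fin d),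
      ENNReal.ofReal (Real.exp (C / 2 * ‖(inner ℂ a z : ℂ)‖ ^ 2)) ≤
        2⁻¹ * ENNReal.ofReal (Real.exp (C * (inner ℂ a z : ℂ).re ^ 2)) +
        2⁻¹ * ENNReal.ofReal (Real.exp (C * (inner ℂ a ((-Complex.I) • z) : ℂ).re ^ 2)) :=
    fun a => by
    have him : (inner ℂ a ((-Complex.I) • z) : ℂ).re = (inner ℂ a z : ℂ).im := by
      simp [inner_smul_right]
    rw [him]
    set X := (inner ℂ a z : ℂ).re
    set Y := (inner ℂ a z : ℂ).im
    have hn : ‖(inner ℂ a z : ℂ)‖ ^ 2 = X ^ 2 + Y ^ 2 := by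
      rw [Complex.sq_norm, Complex.normSq_apply]; ring
    have h2 : (2⁻¹ : ENNReal) = ENNReal.ofReal 2⁻¹ := by
      rw [ENNReal.ofReal_inv_of_pos two_pos]; simp
    rw [hn, h2, ← ENNReal.ofReal_mul (by norm_num), ← ENNReal.ofReal_mul (by norm_num),
      ← ENNReal.ofReal_add (by positivity) (by positivity)]
    refine ENNReal.ofReal_le_ofReal ?_
    have h3 : Real.exp (C / 2 * (X ^ 2 + Y ^ 2)) =
        Real.exp (C / 2 * X ^ 2) * Real.exp (C / 2 * Y ^ 2) := by
      rw [← Real.exp_add]; ring_nf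
    have h4 : ∀ W : ℝ, Real.exp (C * W ^ 2) = Real.exp (C / 2 * W ^ 2) ^ 2 := fun W => by
      rw [← Real.exp_nat_mul]; push_cast; ring_nf
    rw [h3, h4 X, h4 Y]
    linarith [two_mul_le_add_sq (Real.exp (C / 2 * X ^ 2)) (Real.exp (C / 2 * Y ^ 2))]
  calc _ ≤ _ := lintegral_mono hpt
    _ = _ := lintegral_add_left (by fun_prop) _
    _ ≤ 2⁻¹ * ENNReal.ofReal B + 2⁻¹ * ENNReal.ofReal B := by
      rw [lintegral_const_mul _ (by fun_prop), lintegral_const_mul _ (by fun_prop)]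
      gcongr
      exacts [hone z hz, hone _ hz']
    _ = ENNReal.ofReal B := by rw [← add_mul, ENNReal.inv_two_add_inv_two, one_mul]

lemma exists_upper_tail : ∃ L : ℝ, 0 < L ∧
    ∀ (d m : ℕ) (Ω : Type*) [MeasurableSpace Ω] (μ : Measure Ω) [IsProbabilityMeasure μ]
      (a : Fin m → Ω → EuclideanSpace ℂ (Fin d)), (∀ j, HasLaw (a j) (complexGaussian d) μ) →
      iIndepFun a μ → ∀ z : EuclideanSpace ℂ (Fin d),
        μ {ω | L * √(m : ℝ) * ‖z‖ < ‖measMap (fun j => a j ω) z‖} ≤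
          ENNReal.ofReal (Real.exp (-m)) := by
  obtain ⟨C, B, hC, hB, hmom⟩ := exists_exp_moment_bound
  -- Chosen so that `exp (-C L² m) B ^ m ≤ exp (-m)`.
  set L := √((1 + |Real.log B|) / C) with hL
  have hL2 : C * L ^ 2 = 1 + |Real.log B| := by
    rw [hL, Real.sq_sqrt (by positivity)]; field_simp
  refine ⟨L, by positivity, fun d m Ω _ μ _ a ha hind z => ?_⟩
  rcases eq_or_ne z 0 with rfl | hz
  · simp
  have hz0 : 0 < ‖z‖ := norm_pos_iff.2 hz
  set w : EuclideanSpace ℂ (Fin d) := ((‖z‖⁻¹ : ℝ) : ℂ) • z with hw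
  have hw1 : ‖w‖ = 1 := by
    rw [hw, norm_smul, Complex.norm_real, norm_inv, norm_norm, inv_mul_cancel₀ hz0.ne']
  have hzw : z = ((‖z‖ : ℝ) : ℂ) • w := by
    rw [hw, smul_smul, ← Complex.ofReal_mul, mul_inv_cancel₀ hz0.ne']; simp
  have hsub : {ω | L * √(m : ℝ) * ‖z‖ < ‖measMap (fun j => a j ω) z‖} ⊆
      {ω | C * L ^ 2 * m ≤ ∑ j, C * ‖(inner ℂ (a j ω) w : ℂ)‖ ^ 2} := fun ω hω => by
    simp only [Set.mem_ofPred_eq] at hω ⊢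
    have h1 : ‖measMap (fun j => a j ω) z‖ = ‖z‖ * ‖measMap (fun j => a j ω) w‖ := by
      conv_lhs => rw [hzw]
      rw [map_smul, norm_smul, Complex.norm_real, norm_norm]
    rw [h1, mul_comm] at hω
    have h2 := lt_of_mul_lt_mul_left hω hz0.le
    have h3 : (L * √(m : ℝ)) ^ 2 ≤ ‖measMap (fun j => a j ω) w‖ ^ 2 := by gcongr
    rw [mul_pow, Real.sq_sqrt (Nat.cast_nonneg m), EuclideanSpace.norm_sq_eq] at h3
    rw [← Finset.mul_sum, mul_assoc]
    exact mul_le_mul_of_nonneg_left h3 hC.le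
  refine (measure_mono hsub).trans ((measure_sum_ge_le ha hind
    (f := fun x => C * ‖(inner ℂ x w : ℂ)‖ ^ 2) (by fun_prop) _).trans ?_)
  calc _ ≤ ENNReal.ofReal (Real.exp (-(C * L ^ 2 * m))) * ENNReal.ofReal B ^ m := by
        gcongr; exact hmom d w hw1.le
    _ = ENNReal.ofReal (Real.exp (-(C * L ^ 2 * m)) * B ^ m) := by
        rw [← ENNReal.ofReal_pow hB.le, ← ENNReal.ofReal_mul (Real.exp_pos _).le]
    _ ≤ _ := by
        refine ENNReal.ofReal_le_ofReal ?_
        conv_lhs => rw [← Real.exp_log hB]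
        rw [← Real.exp_nat_mul, ← Real.exp_add]
        refine Real.exp_le_exp.2 ?_
        rw [hL2]
        have h := mul_le_mul_of_nonneg_left (le_abs_self (Real.log B)) (Nat.cast_nonneg (α := ℝ) m)
        linarith

lemma gaussianTail_le_one : gaussianTail ≤ 1 := measureReal_le_one

@[fun_prop]
lemma measurable_crossTerm {d : ℕ} (u v : EuclideanSpace ℂ (Fin d)) :
    Measurable (fun a => crossTerm a u v) := by
  unfold crossTerm
  fun_prop

/-- Bound `exp (-g)` by `e⁻¹` where `g ≥ 1` and by `1` elsewhere: the integral is at most `1 - p (1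
- e⁻¹) ≤ 1 - p / 2 ≤ exp (-p / 2)`. -/
lemma lintegral_exp_neg_le_of_le_measure {E : Type*} [MeasurableSpace E] {γ : Measure E}
    [IsProbabilityMeasure γ] {g : E → ℝ} (hg : Measurable g) (hg0 : ∀ x, 0 ≤ g x) {p : ℝ}
    (h : ENNReal.ofReal p ≤ γ {x | 1 ≤ g x}) :
    ∫⁻ x, ENNReal.ofReal (Real.exp (-g x)) ∂γ ≤ ENNReal.ofReal (Real.exp (-(p / 2))) := by
  set S := {x | 1 ≤ g x} with hS
  have hSm : MeasurableSet S := measurableSet_le measurable_const hg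
  have hp : p ≤ γ.real S := by
    rw [← ofReal_measureReal] at h
    exact (ENNReal.ofReal_le_ofReal_iff measureReal_nonneg).1 h
  have hpt : ∀ x, ENNReal.ofReal (Real.exp (-g x)) ≤
      S.indicator (fun _ => ENNReal.ofReal (Real.exp (-1))) x + Sᶜ.indicator (fun _ => 1) x :=
    fun x => by
    by_cases hx : x ∈ S
    · have hx' : 1 ≤ g x := hx
      simp only [hx, Set.indicator_of_mem, Set.mem_compl_iff, not_true_eq_false,
        not_false_eq_true, Set.indicator_of_notMem, add_zero]
      exact ENNReal.ofReal_le_ofReal (Real.exp_le_exp.2 (by linarith))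
    · simp only [hx, not_false_eq_true, Set.indicator_of_notMem, Set.mem_compl_iff,
        Set.indicator_of_mem, zero_add]
      rw [← ENNReal.ofReal_one]
      exact ENNReal.ofReal_le_ofReal (Real.exp_le_one_iff.2 (by linarith [hg0 x]))
  refine (lintegral_mono hpt).trans ?_
  rw [lintegral_add_left (measurable_const.indicator hSm), lintegral_indicator_const hSm,
    lintegral_indicator_const hSm.compl, one_mul, ← ofReal_measureReal, ← ofReal_measureReal,
    ← ENNReal.ofReal_mul (Real.exp_pos _).le,
    ← ENNReal.ofReal_add (by positivity) measureReal_nonneg, probReal_compl_eq_one_sub hSm]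
  refine ENNReal.ofReal_le_ofReal ?_
  have h1 : Real.exp (-1) ≤ 1 / 2 := by
    have := Real.exp_neg_one_lt_d9; linarith
  have h2 := Real.add_one_le_exp (-(p / 2))
  nlinarith [measureReal_nonneg (μ := γ) (s := S)]

/-- Normalise the cross terms by `‖u‖ ‖v‖ / 2`, so that each is at least `1` with probability at
least `p`. The exponential Markov inequality at level `p m / 4` then gives `exp (p m / 4) exp (-p m
/ 2)`. -/
lemma lower_tail {d m : ℕ} {Ω : Type*} [MeasurableSpace Ω] {μ : Measure Ω}
    [IsProbabilityMeasure μ] {a : Fin m → Ω → EuclideanSpace ℂ (Fin d)}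
    (ha : ∀ j, HasLaw (a j) (complexGaussian d) μ) (hind : iIndepFun a μ)
    {u v : EuclideanSpace ℂ (Fin d)} (him : |(inner ℂ u v : ℂ).im| ≤ ‖u‖ * ‖v‖ / 2) :
    μ {ω | ∑ j, |crossTerm (a j ω) u v| < gaussianTail ^ 4 / 8 * m * (‖u‖ * ‖v‖)} ≤
      ENNReal.ofReal (Real.exp (-(gaussianTail ^ 4 / 4 * m))) := by
  set p := gaussianTail ^ 4 with hp
  rcases eq_or_ne (‖u‖ * ‖v‖) 0 with h0 | h0
  · have : {ω | ∑ j, |crossTerm (a j ω) u v| < p / 8 * m * (‖u‖ * ‖v‖)} = ∅ := by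
      refine Set.eq_empty_of_forall_notMem fun ω hω => ?_
      rw [Set.mem_ofPred_eq, h0, mul_zero] at hω
      exact absurd (Finset.sum_nonneg fun j _ => abs_nonneg _) (not_le.2 hω)
    rw [this, measure_empty]
    exact zero_le
  have hpos : 0 < ‖u‖ * ‖v‖ := lt_of_le_of_ne (by positivity) h0.symm
  have hu : u ≠ 0 := fun h => h0 (by simp [h])
  set g : EuclideanSpace ℂ (Fin d) → ℝ := fun x => 2 / (‖u‖ * ‖v‖) * |crossTerm x u v| with hg
  have hsub : {ω | ∑ j, |crossTerm (a j ω) u v| < p / 8 * m * (‖u‖ * ‖v‖)} ⊆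
      {ω | -(p / 4 * m) ≤ ∑ j, -g (a j ω)} := fun ω hω => by
    simp only [Set.mem_ofPred_eq, hg] at hω ⊢
    rw [Finset.sum_neg_distrib, ← Finset.mul_sum, neg_le_neg_iff, div_mul_eq_mul_div,
      div_le_iff₀ hpos]
    linarith
  have hgm : Measurable g := by
    have := (measurable_crossTerm u v).abs
    fun_prop
  refine (measure_mono hsub).trans ((measure_sum_ge_le ha hind (f := fun x => -g x)
    (by fun_prop) _).trans ?_)
  have hset : {x | 1 ≤ g x} = {a | ‖u‖ * ‖v‖ / 2 ≤ |crossTerm a u v|} := by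
    ext x
    simp only [hg, Set.mem_ofPred_eq]
    rw [div_mul_eq_mul_div, le_div_iff₀ hpos]
    constructor <;> intro h <;> linarith
  have hl := lintegral_exp_neg_le_of_le_measure (γ := complexGaussian d) (p := p) hgm
    (fun x => by positivity) (hset ▸ small_ball him hu)
  calc _ ≤ ENNReal.ofReal (Real.exp (- -(p / 4 * m))) *
        ENNReal.ofReal (Real.exp (-(p / 2))) ^ m := by gcongr
    _ = _ := by
      rw [← ENNReal.ofReal_pow (Real.exp_pos _).le, ← ENNReal.ofReal_mul (Real.exp_pos _).le,
        ← Real.exp_nat_mul, ← Real.exp_add]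
      ring_nf

end Tails

/-! ### Extending the bounds from a net to all sparse vectors. -/

section FromNet

variable {d m : ℕ}

lemma norm_measMap_smul (a : Fin m → EuclideanSpace ℂ (Fin d)) (r : ℝ)
    (x : EuclideanSpace ℂ (Fin d)) : ‖measMap a ((r : ℂ) • x)‖ = |r| * ‖measMap a x‖ := by
  rw [map_smul, norm_smul, Complex.norm_real, Real.norm_eq_abs]

lemma SupportedOn.smul {T : Finset (Fin d)} {x : EuclideanSpace ℂ (Fin d)} (h : SupportedOn T x)
    (r : ℂ) : SupportedOn T (r • x) := fun i hi => by simp [h i hi]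

lemma SupportedOn.sub {T : Finset (Fin d)} {x y : EuclideanSpace ℂ (Fin d)} (h : SupportedOn T x)
    (h' : SupportedOn T y) : SupportedOn T (x - y) := fun i hi => by simp [h i hi, h' i hi]

lemma norm_measMap_le_of_unit {a : Fin m → EuclideanSpace ℂ (Fin d)} {T : Finset (Fin d)} {M : ℝ}
    (h : ∀ x, SupportedOn T x → ‖x‖ = 1 → ‖measMap a x‖ ≤ M) (x : EuclideanSpace ℂ (Fin d))
    (hx : SupportedOn T x) : ‖measMap a x‖ ≤ M * ‖x‖ := by
  rcases eq_or_ne x 0 with rfl | hx0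
  · simp
  have hpos : 0 < ‖x‖ := norm_pos_iff.2 hx0
  have := h (((‖x‖⁻¹ : ℝ) : ℂ) • x) (hx.smul _) (by
    rw [norm_smul, Complex.norm_real, norm_inv, norm_norm, inv_mul_cancel₀ hpos.ne'])
  rw [norm_measMap_smul, abs_of_pos (inv_pos.2 hpos), inv_mul_le_iff₀ hpos] at this
  linarith

/-- A bound `M` on the operator improves to `3/2 L √m + M / 2`, whose fixed point is `3 L √m`.
Iterating from the operator norm and passing to the limit gives the constant `3 L`. -/
lemma sparseUpper_of_net {a : Fin m → EuclideanSpace ℂ (Fin d)} {K : ℕ} {L : ℝ}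
    (hL : 0 ≤ L) {N : Finset (EuclideanSpace ℂ (Fin d))}
    (hN : ∀ T : Finset (Fin d), T.card ≤ K → ∀ x, SupportedOn T x → ‖x‖ ≤ 1 →
        ∃ y ∈ N, SupportedOn T y ∧ ‖x - y‖ ≤ 1 / 2)
    (h : ∀ y ∈ N, ‖measMap a y‖ ≤ L * √(m : ℝ) * ‖y‖) : SparseUpper a K (3 * L) := by
  intro T hT
  set B := ‖(measMap a).toContinuousLinearMap‖ with hB
  have hstep : ∀ n : ℕ, ∀ x, SupportedOn T x →
      ‖measMap a x‖ ≤ (3 * L * √(m : ℝ) + (1 / 2) ^ n * B) * ‖x‖ := by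
    intro n
    induction n with
    | zero =>
      intro x _
      have h1 := (measMap a).toContinuousLinearMap.le_opNorm x
      rw [LinearMap.coe_toContinuousLinearMap'] at h1
      rw [pow_zero, one_mul]
      refine h1.trans ?_
      gcongr
      have : 0 ≤ 3 * L * √(m : ℝ) := by positivity
      linarith
    | succ n ih =>
      refine norm_measMap_le_of_unit fun x hx hx1 => ?_
      obtain ⟨y, hy, hyT, hxy⟩ := hN T hT x hx hx1.le
      have h1 := h y hy
      have h2 := ih (x - y) (hx.sub hyT)
      have h3 : ‖measMap a x‖ ≤ ‖measMap a y‖ + ‖measMap a (x - y)‖ := by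
        have := norm_add_le (measMap a y) (measMap a (x - y))
        rwa [← map_add, add_sub_cancel] at this
      have h4 : ‖y‖ ≤ 3 / 2 := by
        have := norm_sub_le x (x - y)
        rw [sub_sub_cancel] at this
        linarith
      calc ‖measMap a x‖ ≤ L * √(m : ℝ) * ‖y‖ +
            (3 * L * √(m : ℝ) + (1 / 2) ^ n * B) * ‖x - y‖ := by linarith
        _ ≤ L * √(m : ℝ) * (3 / 2) + (3 * L * √(m : ℝ) + (1 / 2) ^ n * B) * (1 / 2) := by
            gcongr
        _ = _ := by rw [pow_succ]; ring
  intro x hx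
  have hlim : Filter.Tendsto (fun n : ℕ => (3 * L * √(m : ℝ) + (1 / 2) ^ n * B) * ‖x‖)
      Filter.atTop (nhds ((3 * L * √(m : ℝ) + 0 * B) * ‖x‖)) :=
    (((tendsto_pow_atTop_nhds_zero_of_lt_one (by norm_num) (by norm_num)).mul_const B).const_add
      _).mul_const _
  have := ge_of_tendsto' hlim fun n => hstep n x hx
  simpa using this

lemma abs_im_inner_le_of_near {u v y z : EuclideanSpace ℂ (Fin d)} {ε : ℝ} (hv : ‖v‖ = 1)
    (him : (inner ℂ u v : ℂ).im = 0) (hy : ‖u - y‖ ≤ ε) (hz : ‖v - z‖ ≤ ε) :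
    |(inner ℂ y z : ℂ).im| ≤ ε + ‖y‖ * ε := by
  have e : (inner ℂ y z : ℂ).im = -((inner ℂ (u - y) v : ℂ).im + (inner ℂ y (v - z) : ℂ).im) := by
    simp only [inner_sub_left, inner_sub_right, Complex.sub_im, him]; ring
  rw [e, abs_neg]
  refine (abs_add_le _ _).trans (add_le_add ?_ ?_)
  · refine ((Complex.abs_im_le_norm _).trans (norm_inner_le_norm _ _)).trans ?_
    rwa [hv, mul_one]
  · refine ((Complex.abs_im_le_norm _).trans (norm_inner_le_norm _ _)).trans ?_
    gcongr

lemma crossTerm_smul_right (a u v : EuclideanSpace ℂ (Fin d)) (r : ℝ) :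
    crossTerm a u ((r : ℂ) • v) = r * crossTerm a u v := by
  simp only [crossTerm, inner_smul_right, map_mul, Complex.conj_ofReal, mul_left_comm,
    Complex.re_ofReal_mul]

lemma sparseLower_of_unit {a : Fin m → EuclideanSpace ℂ (Fin d)} {K : ℕ} {c : ℝ}
    (h : ∀ T : Finset (Fin d), T.card ≤ K → ∀ u v, SupportedOn T u → SupportedOn T v →
      ‖u‖ = 1 → ‖v‖ = 1 → (inner ℂ u v : ℂ).im = 0 → c * m ≤ ∑ j, |crossTerm (a j) u v|) :
    SparseLower a K c := by
  intro T hT u v hu hv him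
  rcases eq_or_ne u 0 with rfl | hu0
  · simpa using Finset.sum_nonneg fun j _ => abs_nonneg _
  rcases eq_or_ne v 0 with rfl | hv0
  · simpa using Finset.sum_nonneg fun j _ => abs_nonneg _
  have hup : 0 < ‖u‖ := norm_pos_iff.2 hu0
  have hvp : 0 < ‖v‖ := norm_pos_iff.2 hv0
  have := h T hT (((‖u‖⁻¹ : ℝ) : ℂ) • u) (((‖v‖⁻¹ : ℝ) : ℂ) • v) (hu.smul _) (hv.smul _)
    (by rw [norm_smul, Complex.norm_real, norm_inv, norm_norm, inv_mul_cancel₀ hup.ne'])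
    (by rw [norm_smul, Complex.norm_real, norm_inv, norm_norm, inv_mul_cancel₀ hvp.ne'])
    (by rw [inner_smul_left, inner_smul_right, Complex.conj_ofReal, Complex.im_ofReal_mul,
      Complex.im_ofReal_mul, him, mul_zero, mul_zero])
  simp only [crossTerm_smul_left, crossTerm_smul_right, abs_mul, abs_of_pos (inv_pos.2 hup),
    abs_of_pos (inv_pos.2 hvp), ← Finset.mul_sum] at this
  rw [le_inv_mul_iff₀ hvp, le_inv_mul_iff₀ hup] at this
  linarith

/-- A nearby net pair keeps at least half of the bound, as `(1 - ε)² ≥ 1/2`. Replacing it by the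
true pair costs at most `4 L² ε m ≤ c m / 4`, by `SparseUpper` on the common support. -/
lemma sparseLower_of_net {a : Fin m → EuclideanSpace ℂ (Fin d)} {K : ℕ} {L c ε : ℝ}
    (hL : 0 ≤ L) (hc : 0 < c) (hε0 : 0 ≤ ε) (hε : ε ≤ 1 / 16) (hLε : 16 * L ^ 2 * ε ≤ c)
    {N : Finset (EuclideanSpace ℂ (Fin d))}
    (hN : ∀ T : Finset (Fin d), T.card ≤ K → ∀ x, SupportedOn T x → ‖x‖ ≤ 1 →
        ∃ y ∈ N, SupportedOn T y ∧ ‖x - y‖ ≤ ε)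
    (hU : SparseUpper a K L)
    (h : ∀ y ∈ N, ∀ z ∈ N, |(inner ℂ y z : ℂ).im| ≤ ‖y‖ * ‖z‖ / 2 →
      c * m * (‖y‖ * ‖z‖) ≤ ∑ j, |crossTerm (a j) y z|) : SparseLower a K (c / 4) := by
  refine sparseLower_of_unit fun T hT u v hu hv hu1 hv1 him => ?_
  obtain ⟨y, hy, hyT, huy⟩ := hN T hT u hu hu1.le
  obtain ⟨z, hz, hzT, hvz⟩ := hN T hT v hv hv1.le
  have near : ∀ {x w : EuclideanSpace ℂ (Fin d)}, ‖x‖ = 1 → ‖x - w‖ ≤ ε →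
      1 - ε ≤ ‖w‖ ∧ ‖w‖ ≤ 1 + ε := fun {x w} hx hxw => by
    have h1 := norm_sub_norm_le x w
    have h2 := norm_sub_norm_le w x
    rw [norm_sub_rev] at h2
    constructor <;> linarith
  obtain ⟨hy1, hy2⟩ := near hu1 huy
  obtain ⟨hz1, hz2⟩ := near hv1 hvz
  have hyz : (1 - ε) * (1 - ε) ≤ ‖y‖ * ‖z‖ :=
    mul_le_mul hy1 hz1 (by linarith) (norm_nonneg _)
  have hnet := h y hy z hz (by
    have h1 := abs_im_inner_le_of_near hv1 him huy hvz
    have h2 : ‖y‖ * ε ≤ (1 + ε) * ε := by gcongr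
    nlinarith)
  have hpert := sum_abs_crossTerm_le_add a y z (u - y) (v - z)
  rw [add_sub_cancel, add_sub_cancel] at hpert
  have hAy := hU T hT y hyT
  have hAz := hU T hT z hzT
  have hAu := hU T hT (u - y) (hu.sub hyT)
  have hAv := hU T hT (v - z) (hv.sub hzT)
  have hmm : √(m : ℝ) * √(m : ℝ) = m := Real.mul_self_sqrt (by positivity)
  have herr : ‖measMap a y‖ * ‖measMap a (v - z)‖ + ‖measMap a (u - y)‖ * ‖measMap a z‖ +
      ‖measMap a (u - y)‖ * ‖measMap a (v - z)‖ ≤ c / 4 * m := by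
    calc _ ≤ (L * √(m : ℝ) * ‖y‖) * (L * √(m : ℝ) * ‖v - z‖) +
          (L * √(m : ℝ) * ‖u - y‖) * (L * √(m : ℝ) * ‖z‖) +
          (L * √(m : ℝ) * ‖u - y‖) * (L * √(m : ℝ) * ‖v - z‖) := by gcongr
      _ ≤ (L * √(m : ℝ) * (1 + ε)) * (L * √(m : ℝ) * ε) +
          (L * √(m : ℝ) * ε) * (L * √(m : ℝ) * (1 + ε)) +
          (L * √(m : ℝ) * ε) * (L * √(m : ℝ) * ε) := by gcongr
      _ = L ^ 2 * (√(m : ℝ) * √(m : ℝ)) * (ε * (2 + 3 * ε)) := by ring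
      _ ≤ L ^ 2 * m * (ε * 4) := by rw [hmm]; gcongr; linarith
      _ = (16 * L ^ 2 * ε) / 4 * m := by ring
      _ ≤ c / 4 * m := by gcongr
  have hhalf : c * m * (1 / 2) ≤ c * m * (‖y‖ * ‖z‖) := by
    gcongr
    nlinarith
  linarith

end FromNet

/-! ### The good event and the conclusion. -/

/-- Sparse upper and lower bounds hold simultaneously with overwhelming probability. -/
theorem exists_sparse_bounds_event : ∃ L c : ℝ, 0 ≤ L ∧ 0 < c ∧ ∀ q : ℕ, 1 ≤ q →
    ∃ C₀ κ : ℝ, 0 < C₀ ∧ 0 < κ ∧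
    ∀ (d s m : ℕ), 1 ≤ s → s ≤ d →
      C₀ * ((s : ℝ) * Real.log (Real.exp 1 * (d : ℝ) / (s : ℝ))) ≤ (m : ℝ) →
    ∀ (Ω : Type*) [MeasurableSpace Ω] (μ : Measure Ω) [IsProbabilityMeasure μ]
      (a : Fin m → Ω → EuclideanSpace ℂ (Fin d)),
      (∀ j, HasLaw (a j) (complexGaussian d) μ) → iIndepFun a μ →
      ∃ E : Set Ω, MeasurableSet E ∧ 1 - 2 * Real.exp (-κ * (m : ℝ)) ≤ μ.real E ∧
        ∀ ω ∈ E, SparseUpper (fun j => a j ω) (q * s) L ∧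
          SparseLower (fun j => a j ω) (q * s) c := by
  obtain ⟨L, hL, htail⟩ := exists_upper_tail
  set p := gaussianTail ^ 4 with hp
  have hp0 : 0 < p := pow_pos gaussianTail_pos 4
  have hp1 : p ≤ 1 := pow_le_one₀ gaussianTail_pos.le gaussianTail_le_one
  -- `L` and `c` are fixed before `q`, because the number of blocks will be chosen in terms of `L² /
  -- c`.
  refine ⟨3 * L, p / 8 / 4, by positivity, by positivity, fun q hq => ?_⟩
  obtain ⟨l₀, hl₀⟩ := exists_pow_lt_of_lt_one
    (show 0 < min (1 / 16) (p / 8 / (16 * (3 * L) ^ 2)) by positivity)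
    (show (1 / 2 : ℝ) < 1 by norm_num)
  set ε : ℝ := (1 / 2) ^ l₀ with hε
  have hε1 : ε ≤ 1 / 16 := hl₀.le.trans (min_le_left _ _)
  have hε2 : 16 * (3 * L) ^ 2 * ε ≤ p / 8 := by
    have := hl₀.le.trans (min_le_right _ _)
    rwa [le_div_iff₀' (by positivity)] at this
  set κ : ℝ := q * (1 + 4 * l₀) with hκ
  have hκ0 : 0 < κ := by
    have : (0 : ℝ) < q := by exact_mod_cast hq
    positivity
  -- This `C₀` gives `|N| ≤ exp (p m / 16)`; the union over pairs then costs `exp (p m / 8)` against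
  -- the tail `exp (-p m / 4)`.
  refine ⟨16 * κ / p, p / 8, by positivity, by positivity, ?_⟩
  intro d s m hs hsd hm Ω _ μ _ a ha hind
  obtain ⟨N, hNc, hN⟩ := exists_sparse_net hs hsd hq l₀
  have hNm : (N.card : ℝ) ≤ Real.exp (p / 16 * m) := by
    refine hNc.trans (Real.exp_le_exp.2 ?_)
    rw [← hκ]
    rw [div_mul_eq_mul_div, div_le_iff₀ hp0] at hm
    linarith
  set P : Finset (EuclideanSpace ℂ (Fin d) × EuclideanSpace ℂ (Fin d)) := (N ×ˢ N) with hP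
  set U : EuclideanSpace ℂ (Fin d) → Set Ω := fun z =>
    {ω | L * √(m : ℝ) * ‖z‖ < ‖measMap (fun j => a j ω) z‖} with hUdef
  set W : EuclideanSpace ℂ (Fin d) × EuclideanSpace ℂ (Fin d) → Set Ω := fun y =>
    {ω | |(inner ℂ y.1 y.2 : ℂ).im| ≤ ‖y.1‖ * ‖y.2‖ / 2 ∧
      ∑ j, |crossTerm (a j ω) y.1 y.2| < p / 8 * m * (‖y.1‖ * ‖y.2‖)} with hWdef
  have hW : ∀ y, μ (W y) ≤ ENNReal.ofReal (Real.exp (-(p / 4 * m))) := fun y => by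
    by_cases him : |(inner ℂ y.1 y.2 : ℂ).im| ≤ ‖y.1‖ * ‖y.2‖ / 2
    · exact (measure_mono fun ω hω => hω.2).trans (lower_tail ha hind him)
    · have : W y = ∅ := Set.eq_empty_of_forall_notMem fun ω hω => him hω.1
      rw [this, measure_empty]; exact zero_le
  set Bad : Set Ω := (⋃ z ∈ N, U z) ∪ ⋃ y ∈ P, W y with hBad
  have hBadμ : μ Bad ≤ ENNReal.ofReal (2 * Real.exp (-(p / 8) * m)) := by
    have h1 : μ (⋃ z ∈ N, U z) ≤ ENNReal.ofReal (Real.exp (-(p / 8) * m)) := by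
      calc _ ≤ ∑ z ∈ N, μ (U z) := measure_biUnion_finset_le _ _
        _ ≤ ∑ z ∈ N, ENNReal.ofReal (Real.exp (-m)) :=
            Finset.sum_le_sum fun z _ => htail d m Ω μ a ha hind z
        _ = ENNReal.ofReal (N.card * Real.exp (-m)) := by
            rw [Finset.sum_const, nsmul_eq_mul, ENNReal.ofReal_mul (by positivity),
              ENNReal.ofReal_natCast]
        _ ≤ _ := by
          refine ENNReal.ofReal_le_ofReal ?_
          calc N.card * Real.exp (-m) ≤ Real.exp (p / 16 * m) * Real.exp (-m) := by gcongr
            _ = Real.exp (p / 16 * m + -m) := (Real.exp_add _ _).symm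
            _ ≤ _ := by
              refine Real.exp_le_exp.2 ?_
              have : p * m ≤ 1 * m := by gcongr
              linarith [Nat.cast_nonneg (α := ℝ) m]
    have h2 : μ (⋃ y ∈ P, W y) ≤ ENNReal.ofReal (Real.exp (-(p / 8) * m)) := by
      calc _ ≤ ∑ y ∈ P, μ (W y) := measure_biUnion_finset_le _ _
        _ ≤ ∑ y ∈ P, ENNReal.ofReal (Real.exp (-(p / 4 * m))) :=
            Finset.sum_le_sum fun y _ => hW y
        _ = ENNReal.ofReal (N.card * N.card * Real.exp (-(p / 4 * m))) := by
            rw [Finset.sum_const, nsmul_eq_mul, ENNReal.ofReal_mul (by positivity),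
              hP, Finset.card_product, ← Nat.cast_mul, ENNReal.ofReal_natCast]
        _ ≤ _ := by
          refine ENNReal.ofReal_le_ofReal ?_
          calc N.card * N.card * Real.exp (-(p / 4 * m))
              ≤ Real.exp (p / 16 * m) * Real.exp (p / 16 * m) * Real.exp (-(p / 4 * m)) := by
                gcongr
            _ = _ := by rw [← Real.exp_add, ← Real.exp_add]; ring_nf
    refine (measure_union_le _ _).trans ((add_le_add h1 h2).trans (le_of_eq ?_))
    rw [← ENNReal.ofReal_add (by positivity) (by positivity), two_mul]
  -- The `a j` are only almost everywhere measurable, so `Bad` is replaced by a measurable hull of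
  -- the same measure.
  refine ⟨(toMeasurable μ Bad)ᶜ, (measurableSet_toMeasurable _ _).compl, ?_, fun ω hω => ?_⟩
  · rw [probReal_compl_eq_one_sub (measurableSet_toMeasurable _ _), measureReal_def,
      measure_toMeasurable]
    have := ENNReal.toReal_le_of_le_ofReal (by positivity) hBadμ
    linarith
  · have hω' : ω ∉ Bad := fun h => hω (subset_toMeasurable μ Bad h)
    simp only [hBad, Set.mem_union, Set.mem_iUnion, not_or, not_exists] at hω'
    obtain ⟨hωU, hωW⟩ := hω'
    have hup : SparseUpper (fun j => a j ω) (q * s) (3 * L) := by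
      refine sparseUpper_of_net hL.le (N := N) (fun T hT x hx hx1 => ?_) fun y hy => ?_
      · obtain ⟨y, hy, hyT, hxy⟩ := hN T hT x hx hx1
        exact ⟨y, hy, hyT, hxy.trans (hε1.trans (by norm_num))⟩
      · simpa [hUdef] using hωU y hy
    refine ⟨hup, sparseLower_of_net (by positivity) (by positivity) (by positivity) hε1 hε2 hN hup
      fun y hy z hz him => ?_⟩
    have := hωW (y, z) (Finset.mk_mem_product hy hz)
    simp only [hWdef, Set.mem_ofPred_eq, not_and, not_lt] at this
    exact this him

end

theorem mainTheorem3 :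
    ∃ C₀ c C : ℝ, 0 < C₀ ∧ 0 < c ∧ 0 < C ∧
      ∀ (d s m : ℕ), 1 ≤ s → s ≤ d →
        C₀ * ((s : ℝ) * Real.log (Real.exp 1 * (d : ℝ) / (s : ℝ))) ≤ (m : ℝ) →
      ∀ (Ω : Type*) [MeasurableSpace Ω] (μ : Measure Ω) [IsProbabilityMeasure μ]
        (a : Fin m → Ω → EuclideanSpace ℂ (Fin d)) (η : Ω → EuclideanSpace ℝ (Fin m)),
        (∀ j, HasLaw (a j) (complexGaussian d) μ) →
        iIndepFun a μ →
        AEMeasurable η μ →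
        IndepFun η (fun ω j => a j ω) μ →
        ∃ E : Set Ω, MeasurableSet E ∧ 1 - 5 * Real.exp (-c * (m : ℝ)) ≤ μ.real E ∧
          ∀ ω ∈ E, ∀ x₀ xhat : EuclideanSpace ℂ (Fin d),
            IsSparse s x₀ →
            IsSolution (fun j => a j ω) (intensity (fun j => a j ω) x₀ (η ω)) (l1norm x₀) xhat →
            phaseDist xhat x₀ ≤
              C * min (√‖η ω‖ / (m : ℝ) ^ (1 / 4 : ℝ)) (‖η ω‖ / (‖x₀‖ * √(m : ℝ))) := by
  obtain ⟨L, c, hL, hc, hevent⟩ := exists_sparse_bounds_event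
  -- `n` makes the tail error in `cone_lower_bound` at most half of the main term; the sparsity
  -- level needed is then `(n + 1) s`.
  obtain ⟨n₀, hn₀⟩ := exists_nat_ge ((6 * L ^ 2 / c) ^ 2)
  set n := n₀ + 1 with hn
  have hLn : 3 * L ^ 2 ≤ c / 2 * √(n : ℝ) := by
    have h1 : 6 * L ^ 2 / c ≤ √(n : ℝ) := by
      refine Real.le_sqrt_of_sq_le (hn₀.trans ?_)
      rw [hn]; push_cast; linarith
    rw [div_le_iff₀ hc] at h1
    linarith
  obtain ⟨C₀, κ, hC₀, hκ, h⟩ := hevent (n + 1) (by omega)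
  refine ⟨C₀, κ, 8 / c + 4 / √c, hC₀, hκ, by positivity, ?_⟩
  intro d s m hs hsd hm Ω _ μ _ a η ha hind _ _
  obtain ⟨E, hE, hEμ, hEω⟩ := h d s m hs hsd hm Ω μ a ha hind
  have hm0 : 0 < m := by
    have hsR : (0 : ℝ) < s := by exact_mod_cast hs
    have hsdR : (s : ℝ) ≤ d := by exact_mod_cast hsd
    have hlog : 0 < Real.log (Real.exp 1 * d / s) := by
      refine Real.log_pos ?_
      rw [mul_div_assoc]
      have h1 : 1 < Real.exp 1 := Real.one_lt_exp_iff.2 one_pos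
      have h2 : 1 ≤ (d : ℝ) / s := (one_le_div hsR).2 hsdR
      nlinarith
    have : (0 : ℝ) < m := lt_of_lt_of_le (by positivity) hm
    exact_mod_cast this
  refine ⟨E, hE, ?_, fun ω hω x₀ xhat hx₀ hsol => ?_⟩
  · have := Real.exp_pos (-κ * m)
    linarith
  · obtain ⟨hU, hl⟩ := hEω ω hω
    exact phaseDist_le_of_sparse_bounds hm0 hs (by omega) hL hc hLn hU hl hx₀ hsol
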